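/- Let $(M^m,g)$ and $(N^n,h)$ be smooth Riemannian manifolds (finite-dimensional, Hausdorff, second countable, without boundary) and let $F:[0,\infty)\to[0,\infty)$ be a $C^2$ function with $F(0)=0$ and $F'(t)>0$ for all $t>0$. For a smooth map $u:M\to N$ and a local orthonormal frame $(e_1,\dots,e_m)$ of $M$ put $$\|u^*h\|^2=\sum_{i,j=1}^m h(du(e_i),du(e_j))^2,\qquad \sigma_u(X)=\sum_{j=1}^m h(du(X),du(e_j))\,du(e_j),\qquad \sigma_{F,u}=F'\Big(\frac{\|u^*h\|^2}{4}\Big)\sigma_u .$$ Let $\nabla$ be the Levi-Civita connection of $M$ and $\tilde\nabla$ the connection on $u^{-1}TN$ induced by the Levi-Civita connection of $N$. The map $u$ is called stationary for the functional $\Phi_F(u)=\int_M F\big(\tfrac{\|u^*h\|^2}{4}\big)\,dV_g$ if it satisfies the Euler–Lagrange equation $$\operatorname{div}_g\sigma_{F,u}:=\sum_{i=1}^m\Big\{\tilde\nabla_{e_i}\big(\sigma_{F,u}(e_i)\big)-\sigma_{F,u}(\nabla_{e_i}e_i)\Big\}=0\quad\text{on } M .$$ The stress-energy tensor of $u$ is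 the symmetric $2$-tensor $$S_{\Phi_F,u}(X,Y)=F\Big(\frac{\|u^*h\|^2}{4}\Big)g(X,Y)-F'\Big(\frac{\|u^*h\|^2}{4}\Big)h(\sigma_u(X),du(Y)),$$ with divergence $$(\operatorname{div}S_{\Phi_F,u})(X)=\sum_{k=1}^m\Big\{e_k\big(S_{\Phi_F,u}(e_k,X)\big)-S_{\Phi_F,u}(\nabla_{e_k}e_k,X)-S_{\Phi_F,u}(e_k,\nabla_{e_k}X)\Big\}.$$ Suppose that $u$ is a submersion almost everywhere, i.e. the set of points $x\in M$ at which $du_x:T_xM\to T_{u(x)}N$ is not surjective has measure zero. Then $u$ is stationary for $\Phi_F$ if and only if $\operatorname{div}S_{\Phi_F,u}=0$ on $M$. -/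

import Mathlib

open Bundle
open scoped Manifold ContDiff

noncomputable section

namespace PhiF

/-- The model space `ℝ^m` of an `m`-dimensional manifold. -/
abbrev Model (m : ℕ) : Type := EuclideanSpace ℝ (Fin m)

/-- The tangent space `T_x M` of an `m`-dimensional manifold without boundary. -/
abbrev Tang (m : ℕ) {M : Type*} [TopologicalSpace M] [ChartedSpace (Model m) M] (x : M) : Type :=
  TangentSpace (𝓡 m) x

instance instFiniteDimensionalTang (m : ℕ) {M : Type*} [TopologicalSpace M]
    [ChartedSpace (Model m) M] (x : M) : FiniteDimensional ℝ (Tang m x) :=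
  inferInstanceAs (FiniteDimensional ℝ (Model m))

section Measure

variable {m : ℕ} {M : Type*} [TopologicalSpace M] [ChartedSpace (Model m) M]

variable (m) in
/-- Sets of measure zero in a manifold: the image in each chart is Lebesgue null. On a
second countable smooth manifold these are the null sets of the volume measure of any
Riemannian metric. -/
def IsNull (A : Set M) : Prop :=
  ∀ e ∈ atlas (Model m) M, MeasureTheory.volume (e '' (A ∩ e.source)) = 0

end Measure

section LeviCivita

variable (m : ℕ) {M : Type*} [TopologicalSpace M] [ChartedSpace (Model m) M]
  [IsManifold (𝓡 m) ∞ M]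

/-- The components, in the preferred chart at `x`, of a tangent vector `v` at a nearby point `y`. -/
def coordComp (x y : M) (v : Tang m y) : Model m :=
  (trivializationAt (Model m) (TangentSpace (𝓡 m) : M → Type _) x ⟨y, v⟩).2

/-- The tangent vector at a point `y` near `x` with components `c` in the preferred chart at `x`. -/
def coordVec (x y : M) (c : Model m) : Tang m y :=
  (trivializationAt (Model m) (TangentSpace (𝓡 m) : M → Type _) x).symm y c

/-- The vector field near `x`, extending `v ∈ T_x M`, whose components in the preferred chart
at `x` are constant. -/
def coordField (x : M) (v : Tang m x) (y : M) : Tang m y :=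
  coordVec m x y (coordComp m x x v)

/-- The derivative at `x`, in direction `v ∈ T_x M`, of a vector valued function `f` on `M`. -/
def dirDeriv {V : Type*} [NormedAddCommGroup V] [NormedSpace ℝ V] (f : M → V) (x : M)
    (v : Tang m x) : V :=
  mfderiv (𝓡 m) 𝓘(ℝ, V) f x v

variable [RiemannianBundle (fun x : M => TangentSpace (𝓡 m) x)]

/-- An orthonormal basis `e_1, …, e_d` of `T_x M` (here `d = dim T_x M = m`). -/
def frame (x : M) :
    OrthonormalBasis (Fin (Module.finrank ℝ (Tang m x))) ℝ (Tang m x) :=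
  stdOrthonormalBasis ℝ (Tang m x)

/-- `v ⟨a, b⟩`: the derivative at `x`, in direction `v`, of the metric coefficient
`y ↦ ⟨a, b⟩_y`, where `a, b` are kept constant in the preferred chart at `x`. -/
def metricDeriv (x : M) (v a b : Tang m x) : ℝ :=
  dirDeriv m (fun y => (inner ℝ (coordField m x a y) (coordField m x b y) : ℝ)) x v

/-- The Christoffel symbol `Γ_x(v, w)` of the Levi-Civita connection in the preferred chart at `x`:
`⟨Γ(v, w), z⟩ = (v⟨w, z⟩ + w⟨v, z⟩ - z⟨v, w⟩) / 2` for all `z`. -/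
def christoffel (x : M) (v w : Tang m x) : Tang m x :=
  ∑ k, ((metricDeriv m x v w (frame m x k) + metricDeriv m x w v (frame m x k)
    - metricDeriv m x (frame m x k) v w) / 2) • frame m x k

/-- The Levi-Civita covariant derivative `∇_v Y` at `x` of a vector field `Y`, `v ∈ T_x M`. -/
def leviCivita (Y : ∀ y : M, Tang m y) (x : M) (v : Tang m x) : Tang m x :=
  coordVec m x x (dirDeriv m (fun y => coordComp m x y (Y y)) x v) + christoffel m x v (Y x)

/-- The divergence of a 2-tensor field `S`:
`(div S)(w) = ∑_k (∇_{e_k} S)(e_k, w)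
  = ∑_k (e_k(S(e_k, w)) - S(∇_{e_k} e_k, w) - S(e_k, ∇_{e_k} w))`,
where `e_k` and `w` are extended to vector fields near `x`. -/
def divTensor (S : ∀ y : M, Tang m y → Tang m y → ℝ) (x : M) (w : Tang m x) : ℝ :=
  ∑ k, (dirDeriv m (fun y => S y (coordField m x (frame m x k) y) (coordField m x w y)) x
        (frame m x k)
      - S x (leviCivita m (coordField m x (frame m x k)) x (frame m x k)) w
      - S x (frame m x k) (leviCivita m (coordField m x w) x (frame m x k)))

end LeviCivita

section Maps

variable (m n : ℕ) {M N : Type*}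
  [TopologicalSpace M] [ChartedSpace (Model m) M] [IsManifold (𝓡 m) ∞ M]
  [TopologicalSpace N] [ChartedSpace (Model n) N] [IsManifold (𝓡 n) ∞ N]

/-- The differential `du_x : T_x M → T_{u x} N`. -/
def du (u : M → N) (x : M) : Tang m x →L[ℝ] Tang n (u x) := mfderiv (𝓡 m) (𝓡 n) u x

/-- `u` is a submersion almost everywhere: outside a set of measure zero its differential is
surjective. -/
def IsSubmersionAE (u : M → N) : Prop :=
  IsNull m {x : M | ¬ Function.Surjective (du m n u x)}

variable [RiemannianBundle (fun y : N => TangentSpace (𝓡 n) y)]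

/-- The connection on `u⁻¹TN` induced by the Levi-Civita connection of `N`: the covariant
derivative at `x`, in direction `v ∈ T_x M`, of a section `W` of `u⁻¹TN`. -/
def pullbackConn (u : M → N) (W : ∀ y : M, Tang n (u y)) (x : M) (v : Tang m x) :
    Tang n (u x) :=
  coordVec n (u x) (u x) (dirDeriv m (fun y => coordComp n (u x) (u y) (W y)) x v)
    + christoffel n (u x) (du m n u x v) (W x)

variable [RiemannianBundle (fun x : M => TangentSpace (𝓡 m) x)]

/-- The divergence of a `u⁻¹TN`-valued 1-form `θ` on `M`:
`div θ = ∑_i (∇_{e_i} θ)(e_i) = ∑_i (∇_{e_i} (θ(e_i)) - θ(∇_{e_i} e_i))`, where `e_i` is extended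
to a vector field near `x`. -/
def divForm (u : M → N) (θ : ∀ y : M, Tang m y → Tang n (u y)) (x : M) : Tang n (u x) :=
  ∑ i, (pullbackConn m n u (fun y => θ y (coordField m x (frame m x i) y)) x (frame m x i)
      - θ x (leviCivita m (coordField m x (frame m x i)) x (frame m x i)))

/-- `‖u^*h‖² = ∑_{i,j} ⟨du(e_i), du(e_j)⟩²`. -/
def pullbackNormSq (u : M → N) (x : M) : ℝ :=
  ∑ i, ∑ j, (inner ℝ (du m n u x (frame m x i)) (du m n u x (frame m x j)) : ℝ) ^ 2

/-- `σ_u(v) = ∑_j ⟨du(v), du(e_j)⟩ du(e_j)`. -/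
def sigma (u : M → N) (x : M) (v : Tang m x) : Tang n (u x) :=
  ∑ j, (inner ℝ (du m n u x v) (du m n u x (frame m x j)) : ℝ) • du m n u x (frame m x j)

/-- `F'(‖u^*h‖² / 4)`, with the one-sided derivative at `0` as `F` lives on `[0, ∞)`. -/
def weight (F : ℝ → ℝ) (u : M → N) (x : M) : ℝ :=
  derivWithin F (Set.Ici 0) (pullbackNormSq m n u x / 4)

/-- The `u⁻¹TN`-valued 1-form `σ_{F,u} = F'(‖u^*h‖² / 4) σ_u`. -/
def sigmaF (F : ℝ → ℝ) (u : M → N) (x : M) (v : Tang m x) : Tang n (u x) :=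
  weight m n F u x • sigma m n u x v

/-- The stress-energy tensor
`S_{Φ_F,u}(X, Y) = F(‖u^*h‖² / 4) ⟨X, Y⟩ - F'(‖u^*h‖² / 4) ⟨σ_u(X), du(Y)⟩`. -/
def stressEnergy (F : ℝ → ℝ) (u : M → N) (x : M) (v w : Tang m x) : ℝ :=
  F (pullbackNormSq m n u x / 4) * inner ℝ v w
    - weight m n F u x * inner ℝ (sigma m n u x v) (du m n u x w)

/-- `u` is stationary for `Φ_F`: it solves the Euler-Lagrange equation `div σ_{F,u} = 0`. -/
def IsStationary (F : ℝ → ℝ) (u : M → N) : Prop :=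
  ∀ x : M, divForm m n u (sigmaF m n F u) x = 0

/-- `div S_{Φ_F,u} = 0`. -/
def IsDivergenceFreeStress (F : ℝ → ℝ) (u : M → N) : Prop :=
  ∀ (x : M) (w : Tang m x), divTensor m (stressEnergy m n F u) x w = 0

end Maps

end PhiF

end

/-!
Everything rests on the pointwise identity

  `(div S)(w) = -⟨div σ_{F,u}, du(w)⟩`   (`divTensor_stressEnergy`),

which gives the direct implication at once. It comes from the Leibniz rule and the compatibility of
the connections with the metrics (`dirDeriv_inner`). The derivative of `F(‖u^*h‖² / 4)` in the
direction `w` then equals `∑_i ⟨(∇_w du)(e_i), σ_{F,u}(e_i)⟩`, and it cancels the term `∑_i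
⟨σ_{F,u}(e_i), (∇_{e_i} du)(w)⟩` because the second fundamental form `∇du` is symmetric
(`secondFundamentalForm_symm`, `dirDeriv_pullbackNormSq`).

For the converse, suppose `div S = 0`. Where `du` is surjective the identity yields
`div σ_{F,u} = 0`. The set of such points is dense, since its complement is a null set
(`IsSubmersionAE.dense`), and `div σ_{F,u}` is continuous (`continuousAt_inner_divForm`), so it
vanishes everywhere. The divergence is defined at each point with the preferred chart at that
point, which varies discontinuously; continuity holds because the induced connection can be
computed in any chart (`pullbackConn_eq_connAt`). This in turn is the transformation law of the
Christoffel symbols (`christoffelAt_change`), obtained from the Koszul formula. Moreover the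
divergence depends neither on the orthonormal frame nor on its extension to vector fields
(`divForm_eq_sum`), so near a point it can be computed in one frame of class `C¹`, the Gram-Schmidt
orthonormalization of a coordinate frame.

The function `F` is only `C²` on `[0, ∞)`, so its derivatives at `0` are one-sided; composition
with the nonnegative function `‖u^*h‖² / 4` is still differentiable.
-/

noncomputable section

namespace PhiF

open Filter Topology

set_option linter.unusedSectionVars false

/-! ### Derivatives of vector valued functions -/

section Calculus

variable {m n : ℕ} {M N : Type*}
  [TopologicalSpace M] [ChartedSpace (Model m) M]
  [TopologicalSpace N] [ChartedSpace (Model n) N]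
  {V W Z : Type*} [NormedAddCommGroup V] [NormedSpace ℝ V]
  [NormedAddCommGroup W] [NormedSpace ℝ W] [NormedAddCommGroup Z] [NormedSpace ℝ Z]
  {x : M}

/-- The derivative at `x` of a vector valued function, as a linear map on the model space. -/
def modelDeriv (f : M → V) (x : M) : Model m →L[ℝ] V := mfderiv (𝓡 m) 𝓘(ℝ, V) f x

theorem dirDeriv_eq_modelDeriv (f : M → V) (x : M) (v : Tang m x) :
    dirDeriv m f x v = modelDeriv f x v := rfl

theorem hasFDerivAt_comp_extChartAt_symm {f : M → V} (hf : MDifferentiableAt (𝓡 m) 𝓘(ℝ, V) f x) :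
    HasFDerivAt (f ∘ (extChartAt (𝓡 m) x).symm) (modelDeriv f x) (extChartAt (𝓡 m) x x) := by
  have h : HasFDerivWithinAt (f ∘ (extChartAt (𝓡 m) x).symm) (modelDeriv f x)
      (Set.range (𝓡 m)) (extChartAt (𝓡 m) x x) := hf.hasMFDerivAt.2
  rwa [modelWithCornersSelf_coe, Set.range_id, hasFDerivWithinAt_univ] at h

theorem dirDeriv_eq_of_hasFDerivAt {f : M → V} (hf : MDifferentiableAt (𝓡 m) 𝓘(ℝ, V) f x)
    {D : Model m →L[ℝ] V}
    (hD : HasFDerivAt (f ∘ (extChartAt (𝓡 m) x).symm) D (extChartAt (𝓡 m) x x)) (v : Tang m x) :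
    dirDeriv m f x v = D v := by
  rw [dirDeriv_eq_modelDeriv, (hasFDerivAt_comp_extChartAt_symm hf).unique hD]

theorem dirDeriv_congr {f g : M → V} (h : f =ᶠ[𝓝 x] g) (v : Tang m x) :
    dirDeriv m f x v = dirDeriv m g x v := by
  unfold dirDeriv
  exact congrArg (fun L : Model m →L[ℝ] V => L v) h.mfderiv_eq

@[simp] theorem dirDeriv_const (a : V) (v : Tang m x) : dirDeriv m (fun _ : M => a) x v = 0 := by
  unfold dirDeriv
  rw [mfderiv_const]
  rfl

theorem dirDeriv_dir_add (f : M → V) (v w : Tang m x) :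
    dirDeriv m f x (v + w) = dirDeriv m f x v + dirDeriv m f x w :=
  map_add (mfderiv (𝓡 m) 𝓘(ℝ, V) f x) v w

theorem dirDeriv_dir_smul (f : M → V) (a : ℝ) (v : Tang m x) :
    dirDeriv m f x (a • v) = a • dirDeriv m f x v :=
  map_smul (mfderiv (𝓡 m) 𝓘(ℝ, V) f x) a v

theorem mdifferentiableAt_iff_comp_symm {f : M → V} :
    MDifferentiableAt (𝓡 m) 𝓘(ℝ, V) f x ↔ ContinuousAt f x ∧
      DifferentiableAt ℝ (E := Model m) (f ∘ (extChartAt (𝓡 m) x).symm)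
        (extChartAt (𝓡 m) x x) := by
  rw [mdifferentiableAt_iff, modelWithCornersSelf_coe, Set.range_id, differentiableWithinAt_univ]
  rfl

theorem mdifferentiableAt_bilin (B : V →L[ℝ] W →L[ℝ] Z) {f : M → V} {g : M → W}
    (hf : MDifferentiableAt (𝓡 m) 𝓘(ℝ, V) f x) (hg : MDifferentiableAt (𝓡 m) 𝓘(ℝ, W) g x) :
    MDifferentiableAt (𝓡 m) 𝓘(ℝ, Z) (fun y => B (f y) (g y)) x := by
  rw [mdifferentiableAt_iff_comp_symm]
  exact ⟨((B.continuous.continuousAt.comp hf.continuousAt).clm_apply hg.continuousAt),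
    (B.hasFDerivAt_of_bilinear (hasFDerivAt_comp_extChartAt_symm hf)
      (hasFDerivAt_comp_extChartAt_symm hg)).differentiableAt⟩

theorem dirDeriv_bilin (B : V →L[ℝ] W →L[ℝ] Z) {f : M → V} {g : M → W}
    (hf : MDifferentiableAt (𝓡 m) 𝓘(ℝ, V) f x) (hg : MDifferentiableAt (𝓡 m) 𝓘(ℝ, W) g x)
    (v : Tang m x) :
    dirDeriv m (fun y => B (f y) (g y)) x v
      = B (dirDeriv m f x v) (g x) + B (f x) (dirDeriv m g x v) := by
  have h := B.hasFDerivAt_of_bilinear (hasFDerivAt_comp_extChartAt_symm hf)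
    (hasFDerivAt_comp_extChartAt_symm hg)
  rw [dirDeriv_eq_of_hasFDerivAt (mdifferentiableAt_bilin B hf hg) h]
  have hx : (extChartAt (𝓡 m) x).symm (extChartAt (𝓡 m) x x) = x := extChartAt_to_inv x
  simp only [Function.comp_apply, hx]
  exact add_comm _ _

theorem dirDeriv_add {f g : M → V} (hf : MDifferentiableAt (𝓡 m) 𝓘(ℝ, V) f x)
    (hg : MDifferentiableAt (𝓡 m) 𝓘(ℝ, V) g x) (v : Tang m x) :
    dirDeriv m (fun y => f y + g y) x v = dirDeriv m f x v + dirDeriv m g x v := by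
  unfold dirDeriv
  have := (hf.hasMFDerivAt.add hg.hasMFDerivAt).mfderiv
  exact congrArg (fun L : Model m →L[ℝ] V => L v) this

theorem dirDeriv_sub {f g : M → V} (hf : MDifferentiableAt (𝓡 m) 𝓘(ℝ, V) f x)
    (hg : MDifferentiableAt (𝓡 m) 𝓘(ℝ, V) g x) (v : Tang m x) :
    dirDeriv m (fun y => f y - g y) x v = dirDeriv m f x v - dirDeriv m g x v := by
  unfold dirDeriv
  have := (hf.hasMFDerivAt.sub hg.hasMFDerivAt).mfderiv
  exact congrArg (fun L : Model m →L[ℝ] V => L v) this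

theorem dirDeriv_smul {f : M → ℝ} {g : M → V} (hf : MDifferentiableAt (𝓡 m) 𝓘(ℝ, ℝ) f x)
    (hg : MDifferentiableAt (𝓡 m) 𝓘(ℝ, V) g x) (v : Tang m x) :
    dirDeriv m (fun y => f y • g y) x v = dirDeriv m f x v • g x + f x • dirDeriv m g x v :=
  dirDeriv_bilin (ContinuousLinearMap.lsmul ℝ ℝ) hf hg v

theorem dirDeriv_mul {f g : M → ℝ} (hf : MDifferentiableAt (𝓡 m) 𝓘(ℝ, ℝ) f x)
    (hg : MDifferentiableAt (𝓡 m) 𝓘(ℝ, ℝ) g x) (v : Tang m x) :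
    dirDeriv m (fun y => f y * g y) x v = dirDeriv m f x v * g x + f x * dirDeriv m g x v :=
  dirDeriv_smul hf hg v

theorem dirDeriv_clm_apply {f : M → W →L[ℝ] Z} {g : M → W}
    (hf : MDifferentiableAt (𝓡 m) 𝓘(ℝ, W →L[ℝ] Z) f x)
    (hg : MDifferentiableAt (𝓡 m) 𝓘(ℝ, W) g x) (v : Tang m x) :
    dirDeriv m (fun y => f y (g y)) x v = dirDeriv m f x v (g x) + f x (dirDeriv m g x v) :=
  dirDeriv_bilin (ContinuousLinearMap.id ℝ (W →L[ℝ] Z)) hf hg v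

theorem mdifferentiableAt_clm_apply {f : M → W →L[ℝ] Z} {g : M → W}
    (hf : MDifferentiableAt (𝓡 m) 𝓘(ℝ, W →L[ℝ] Z) f x)
    (hg : MDifferentiableAt (𝓡 m) 𝓘(ℝ, W) g x) :
    MDifferentiableAt (𝓡 m) 𝓘(ℝ, Z) (fun y => f y (g y)) x :=
  mdifferentiableAt_bilin (ContinuousLinearMap.id ℝ (W →L[ℝ] Z)) hf hg

theorem dirDeriv_comp_map {u : M → N} {f : N → V}
    (hf : MDifferentiableAt (𝓡 n) 𝓘(ℝ, V) f (u x)) (hu : MDifferentiableAt (𝓡 m) (𝓡 n) u x)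
    (v : Tang m x) :
    dirDeriv m (fun y => f (u y)) x v = dirDeriv n f (u x) (du m n u x v) := by
  unfold dirDeriv du
  have := mfderiv_comp x hf hu
  exact congrArg (fun L : Model m →L[ℝ] V => L v) this

theorem mdifferentiableAt_comp_map {u : M → N} {f : N → V}
    (hf : MDifferentiableAt (𝓡 n) 𝓘(ℝ, V) f (u x)) (hu : MDifferentiableAt (𝓡 m) (𝓡 n) u x) :
    MDifferentiableAt (𝓡 m) 𝓘(ℝ, V) (fun y => f (u y)) x :=
  MDifferentiableAt.comp (g := f) x hf hu

theorem dirDeriv_sum {ι : Type*} (s : Finset ι) {f : ι → M → V}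
    (hf : ∀ i ∈ s, MDifferentiableAt (𝓡 m) 𝓘(ℝ, V) (f i) x) (v : Tang m x) :
    MDifferentiableAt (𝓡 m) 𝓘(ℝ, V) (fun y => ∑ i ∈ s, f i y) x ∧
    dirDeriv m (fun y => ∑ i ∈ s, f i y) x v = ∑ i ∈ s, dirDeriv m (f i) x v := by
  classical
  induction s using Finset.induction_on with
  | empty => simpa using mdifferentiableAt_const
  | insert a s ha ih =>
    obtain ⟨h1, h2⟩ := ih fun i hi => hf i (Finset.mem_insert_of_mem hi)
    have h0 := hf a (Finset.mem_insert_self a s)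
    simp only [Finset.sum_insert ha]
    exact ⟨h0.add h1, by rw [dirDeriv_add h0 h1, h2]⟩

/-- The chain rule for an outer function that is only differentiable on `[0, ∞)`. -/
theorem dirDeriv_comp_derivWithin {F : ℝ → ℝ} {φ : M → ℝ}
    (hφ : MDifferentiableAt (𝓡 m) 𝓘(ℝ, ℝ) φ x) (hpos : ∀ y, 0 ≤ φ y)
    (hF : DifferentiableWithinAt ℝ F (Set.Ici 0) (φ x)) (v : Tang m x) :
    MDifferentiableAt (𝓡 m) 𝓘(ℝ, ℝ) (fun y => F (φ y)) x ∧
    dirDeriv m (fun y => F (φ y)) x v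
      = derivWithin F (Set.Ici 0) (φ x) * dirDeriv m φ x v := by
  have hx : φ ((extChartAt (𝓡 m) x).symm (extChartAt (𝓡 m) x x)) = φ x := by simp
  have h1 := hasFDerivAt_comp_extChartAt_symm hφ
  have h2 : HasDerivWithinAt F (derivWithin F (Set.Ici 0) (φ x)) (Set.Ici 0)
      ((φ ∘ (extChartAt (𝓡 m) x).symm) (extChartAt (𝓡 m) x x)) := by
    simpa only [Function.comp_apply, hx] using hF.hasDerivWithinAt
  have h3 := HasDerivWithinAt.comp_hasFDerivAt_of_eq (extChartAt (𝓡 m) x x) h2 h1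
    (Eventually.of_forall fun y => hpos _) rfl
  have hd : MDifferentiableAt (𝓡 m) 𝓘(ℝ, ℝ) (fun y => F (φ y)) x := by
    rw [mdifferentiableAt_iff_comp_symm]
    refine ⟨?_, h3.differentiableAt⟩
    exact (hF.continuousWithinAt.tendsto.comp
      (tendsto_nhdsWithin_iff.2 ⟨hφ.continuousAt.tendsto, Eventually.of_forall hpos⟩))
  refine ⟨hd, ?_⟩
  rw [dirDeriv_eq_of_hasFDerivAt hd h3]
  rfl

end Calculus

/-! ### Components of vectors and of maps in charts -/

section Coordinates

variable {m n : ℕ} {M N : Type*}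
  [TopologicalSpace M] [ChartedSpace (Model m) M] [IsManifold (𝓡 m) ∞ M]
  [TopologicalSpace N] [ChartedSpace (Model n) N] [IsManifold (𝓡 n) ∞ N]
  {V : Type*} [NormedAddCommGroup V] [NormedSpace ℝ V]
  {c x : M}

variable {u : M → N} {c' : N}

theorem eventually_mem_source (hx : x ∈ (chartAt (Model m) c).source) :
    ∀ᶠ y in 𝓝 x, y ∈ (chartAt (Model m) c).source :=
  (chartAt (Model m) c).open_source.mem_nhds hx

theorem extChartAt_symm_apply (hx : x ∈ (chartAt (Model m) c).source) :
    (extChartAt (𝓡 m) c).symm (extChartAt (𝓡 m) c x) = x :=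
  (extChartAt (𝓡 m) c).left_inv (by rwa [extChartAt_source])

theorem contMDiffAt_extChartAt_comp (hx' : u x ∈ (chartAt (Model n) c').source)
    (hu : ContMDiffAt (𝓡 m) (𝓡 n) ∞ u x) :
    ContMDiffAt (𝓡 m) 𝓘(ℝ, Model n) ∞ (extChartAt (𝓡 n) c' ∘ u) x :=
  ContMDiffAt.comp (I' := 𝓡 n) x (contMDiffAt_extChartAt' hx') hu

/-- `coordComp` as a continuous linear map. -/
def coordCompL (c x : M) : Tang m x →L[ℝ] Model m :=
  (trivializationAt (Model m) (TangentSpace (𝓡 m) : M → Type _) c).continuousLinearMapAt ℝ x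

/-- `coordVec` as a continuous linear map. -/
def coordVecL (c x : M) : Model m →L[ℝ] Tang m x :=
  (trivializationAt (Model m) (TangentSpace (𝓡 m) : M → Type _) c).symmL ℝ x

theorem mem_baseSet_iff :
    x ∈ (trivializationAt (Model m) (TangentSpace (𝓡 m) : M → Type _) c).baseSet ↔
      x ∈ (chartAt (Model m) c).source := by
  rw [TangentBundle.trivializationAt_baseSet]

theorem coordComp_eq (hx : x ∈ (chartAt (Model m) c).source) (v : Tang m x) :
    coordComp m c x v = coordCompL c x v := by
  unfold coordComp coordCompL
  rw [Trivialization.continuousLinearMapAt_apply, Trivialization.coe_linearMapAt_of_mem _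
    (mem_baseSet_iff.2 hx)]

theorem coordVec_eq (hx : x ∈ (chartAt (Model m) c).source) (a : Model m) :
    coordVec m c x a = coordVecL c x a :=
  (Trivialization.symmL_apply (R := ℝ) _ (mem_baseSet_iff.2 hx) a).symm

theorem coordComp_coordVec (hx : x ∈ (chartAt (Model m) c).source) (a : Model m) :
    coordComp m c x (coordVec m c x a) = a := by
  rw [coordComp_eq hx, coordVec_eq hx]
  exact Trivialization.continuousLinearMapAt_symmL (R := ℝ) _ (mem_baseSet_iff.2 hx) a

theorem coordVec_coordComp (hx : x ∈ (chartAt (Model m) c).source) (v : Tang m x) :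
    coordVec m c x (coordComp m c x v) = v := by
  rw [coordComp_eq hx, coordVec_eq hx]
  exact Trivialization.symmL_continuousLinearMapAt (R := ℝ) _ (mem_baseSet_iff.2 hx) v

theorem coordComp_add (hx : x ∈ (chartAt (Model m) c).source) (v w : Tang m x) :
    coordComp m c x (v + w) = coordComp m c x v + coordComp m c x w := by
  simp only [coordComp_eq hx]
  exact map_add _ v w

theorem coordComp_smul (hx : x ∈ (chartAt (Model m) c).source) (a : ℝ) (v : Tang m x) :
    coordComp m c x (a • v) = a • coordComp m c x v := by
  simp only [coordComp_eq hx]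
  exact map_smul _ a v

theorem coordVec_add (hx : x ∈ (chartAt (Model m) c).source) (a b : Model m) :
    coordVec m c x (a + b) = coordVec m c x a + coordVec m c x b := by
  simp only [coordVec_eq hx]
  exact map_add _ a b

theorem coordVec_smul (hx : x ∈ (chartAt (Model m) c).source) (r : ℝ) (a : Model m) :
    coordVec m c x (r • a) = r • coordVec m c x a := by
  simp only [coordVec_eq hx]
  exact map_smul _ r a

theorem mdifferentiableAt_extChartAt' (hx : x ∈ (chartAt (Model m) c).source) :
    MDifferentiableAt (𝓡 m) 𝓘(ℝ, Model m) (extChartAt (𝓡 m) c) x :=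
  mdifferentiableAt_extChartAt hx

theorem dirDeriv_extChartAt (hx : x ∈ (chartAt (Model m) c).source) (v : Tang m x) :
    dirDeriv m (extChartAt (𝓡 m) c) x v = coordComp m c x v := by
  rw [coordComp_eq hx]
  unfold dirDeriv coordCompL
  exact congrArg (fun L : Model m →L[ℝ] Model m => L v)
    (TangentBundle.continuousLinearMapAt_trivializationAt hx).symm

theorem contMDiffAt_extChartAt_symm (hx : x ∈ (chartAt (Model m) c).source) :
    ContMDiffAt 𝓘(ℝ, Model m) (𝓡 m) ∞ (extChartAt (𝓡 m) c).symm (extChartAt (𝓡 m) c x) := by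
  have hmem : extChartAt (𝓡 m) c x ∈ (extChartAt (𝓡 m) c).target :=
    (extChartAt (𝓡 m) c).map_source (by rwa [extChartAt_source])
  exact (contMDiffOn_extChartAt_symm c).contMDiffAt
    ((isOpen_extChartAt_target c).mem_nhds hmem)

theorem contDiffAt_comp_symm {k : WithTop ℕ∞} (hk : k ≤ ∞) {f : M → V}
    (hx : x ∈ (chartAt (Model m) c).source) (hf : ContMDiffAt (𝓡 m) 𝓘(ℝ, V) k f x) :
    ContDiffAt ℝ k (f ∘ (extChartAt (𝓡 m) c).symm) (extChartAt (𝓡 m) c x) := by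
  rw [← contMDiffAt_iff_contDiffAt]
  refine ContMDiffAt.comp (I' := 𝓡 m) _ ?_ ((contMDiffAt_extChartAt_symm hx).of_le hk)
  rwa [extChartAt_symm_apply hx]

theorem differentiableAt_comp_symm {f : M → V}
    (hx : x ∈ (chartAt (Model m) c).source) (hf : MDifferentiableAt (𝓡 m) 𝓘(ℝ, V) f x) :
    DifferentiableAt ℝ (f ∘ (extChartAt (𝓡 m) c).symm) (extChartAt (𝓡 m) c x) := by
  rw [← mdifferentiableAt_iff_differentiableAt]
  refine MDifferentiableAt.comp (I' := 𝓡 m) _ ?_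
    ((contMDiffAt_extChartAt_symm hx).mdifferentiableAt (by simp))
  rwa [extChartAt_symm_apply hx]

/-- The directional derivative of a vector valued function, computed in any chart around `x`. -/
theorem dirDeriv_eq_fderiv {f : M → V} (hx : x ∈ (chartAt (Model m) c).source)
    (hf : MDifferentiableAt (𝓡 m) 𝓘(ℝ, V) f x) (v : Tang m x) :
    dirDeriv m f x v
      = fderiv ℝ (f ∘ (extChartAt (𝓡 m) c).symm) (extChartAt (𝓡 m) c x) (coordComp m c x v) := by
  have hfe : f =ᶠ[𝓝 x] fun y => (f ∘ (extChartAt (𝓡 m) c).symm) (extChartAt (𝓡 m) c y) := by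
    filter_upwards [eventually_mem_source hx] with y hy
    simp only [Function.comp_apply, extChartAt_symm_apply hy]
  rw [dirDeriv_congr hfe]
  have h1 := hasFDerivAt_comp_extChartAt_symm (mdifferentiableAt_extChartAt' hx)
  have hx' : (extChartAt (𝓡 m) c ∘ (extChartAt (𝓡 m) x).symm) (extChartAt (𝓡 m) x x)
      = extChartAt (𝓡 m) c x := by
    simp only [Function.comp_apply, extChartAt_to_inv]
  have h2 := (differentiableAt_comp_symm hx hf).hasFDerivAt
  rw [← hx'] at h2
  have h3 := h2.comp _ h1
  rw [dirDeriv_eq_of_hasFDerivAt (hf.congr_of_eventuallyEq hfe.symm) h3, hx',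
    ← dirDeriv_extChartAt hx]
  rfl

variable (m n) in
/-- The differential of `u` in the charts at `c` and `c'`: the Fréchet derivative of the local
representative of `u`. -/
def duCoord (c : M) (c' : N) (u : M → N) (y : M) : Model m →L[ℝ] Model n :=
  fderiv ℝ (extChartAt (𝓡 n) c' ∘ u ∘ (extChartAt (𝓡 m) c).symm) (extChartAt (𝓡 m) c y)

theorem coordComp_du (hx : x ∈ (chartAt (Model m) c).source)
    (hx' : u x ∈ (chartAt (Model n) c').source) (hu : ContMDiffAt (𝓡 m) (𝓡 n) ∞ u x)
    (v : Tang m x) :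
    coordComp n c' (u x) (du m n u x v) = duCoord m n c c' u x (coordComp m c x v) := by
  have h1 := dirDeriv_eq_fderiv hx
    ((contMDiffAt_extChartAt_comp hx' hu).mdifferentiableAt (by simp)) v
  have h2 := dirDeriv_comp_map (mdifferentiableAt_extChartAt' hx') (hu.mdifferentiableAt (by simp)) v
  rw [dirDeriv_extChartAt hx'] at h2
  rw [← h2]
  exact h1

theorem contDiffAt_fderiv_local (hx : x ∈ (chartAt (Model m) c).source)
    (hx' : u x ∈ (chartAt (Model n) c').source) (hu : ContMDiffAt (𝓡 m) (𝓡 n) ∞ u x) :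
    ContDiffAt ℝ 1 (fderiv ℝ (extChartAt (𝓡 n) c' ∘ u ∘ (extChartAt (𝓡 m) c).symm))
      (extChartAt (𝓡 m) c x) :=
  (contDiffAt_comp_symm le_rfl hx (contMDiffAt_extChartAt_comp hx' hu)).fderiv_right
    (m := 1) (by decide)

theorem contMDiffAt_duCoord (hx : x ∈ (chartAt (Model m) c).source)
    (hx' : u x ∈ (chartAt (Model n) c').source) (hu : ContMDiffAt (𝓡 m) (𝓡 n) ∞ u x) :
    ContMDiffAt (𝓡 m) 𝓘(ℝ, Model m →L[ℝ] Model n) 1 (duCoord m n c c' u) x :=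
  ContMDiffAt.comp (I' := 𝓘(ℝ, Model m)) x (contDiffAt_fderiv_local hx hx' hu).contMDiffAt
    (contMDiffAt_extChartAt' hx)

/-- Symmetry of the second derivative of a smooth map, in arbitrary charts. -/
theorem dirDeriv_duCoord_symm (hx : x ∈ (chartAt (Model m) c).source)
    (hx' : u x ∈ (chartAt (Model n) c').source) (hu : ContMDiffAt (𝓡 m) (𝓡 n) ∞ u x)
    (v w : Tang m x) :
    dirDeriv m (duCoord m n c c' u) x v (coordComp m c x w)
      = dirDeriv m (duCoord m n c c' u) x w (coordComp m c x v) := by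
  have key : ∀ v : Tang m x, dirDeriv m (duCoord m n c c' u) x v
      = fderiv ℝ (fderiv ℝ (extChartAt (𝓡 n) c' ∘ u ∘ (extChartAt (𝓡 m) c).symm))
        (extChartAt (𝓡 m) c x) (coordComp m c x v) := by
    intro v
    rw [dirDeriv_eq_fderiv hx ((contMDiffAt_duCoord hx hx' hu).mdifferentiableAt (by simp))]
    have : duCoord m n c c' u ∘ (extChartAt (𝓡 m) c).symm =ᶠ[𝓝 (extChartAt (𝓡 m) c x)]
        fderiv ℝ (extChartAt (𝓡 n) c' ∘ u ∘ (extChartAt (𝓡 m) c).symm) := by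
      have hmem : extChartAt (𝓡 m) c x ∈ (extChartAt (𝓡 m) c).target :=
        (extChartAt (𝓡 m) c).map_source (by rwa [extChartAt_source])
      filter_upwards [(isOpen_extChartAt_target c).mem_nhds hmem] with z hz
      simp only [Function.comp_apply, duCoord, (extChartAt (𝓡 m) c).right_inv hz]
    rw [this.fderiv_eq]
  rw [key, key]
  exact (contDiffAt_comp_symm le_rfl hx (contMDiffAt_extChartAt_comp hx' hu)).isSymmSndFDerivAt
    (by rw [minSmoothness_of_isRCLikeNormedField]; decide) _ _

/-- For a `C¹` function on `N` and a section `A` of `u⁻¹TN` with continuous components, the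
derivative in the direction of `A` is continuous along `u`. -/
theorem continuousAt_dirDeriv {f : N → V} (hx : u x ∈ (chartAt (Model n) c').source)
    (hu : ContinuousAt u x) (hf : ContMDiffAt (𝓡 n) 𝓘(ℝ, V) 1 f (u x))
    {A : ∀ y : M, Tang n (u y)} (hA : ContinuousAt (fun y => coordComp n c' (u y) (A y)) x) :
    ContinuousAt (fun y => dirDeriv n f (u y) (A y)) x := by
  have h1 : ∀ᶠ q in 𝓝 (u x), ContMDiffAt (𝓡 n) 𝓘(ℝ, V) 1 f q :=
    (contMDiffAt_iff_contMDiffAt_nhds (by simp)).1 hf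
  have h2 : (fun y => fderiv ℝ (f ∘ (extChartAt (𝓡 n) c').symm) (extChartAt (𝓡 n) c' (u y))
      (coordComp n c' (u y) (A y))) =ᶠ[𝓝 x] fun y => dirDeriv n f (u y) (A y) := by
    filter_upwards [hu.eventually h1, hu.eventually (eventually_mem_source hx)] with y hy hy'
    rw [dirDeriv_eq_fderiv hy' (hy.mdifferentiableAt (by simp))]
  refine ContinuousAt.congr ?_ h2
  refine ContinuousAt.clm_apply ?_ hA
  have h3 : ContinuousAt (fderiv ℝ (f ∘ (extChartAt (𝓡 n) c').symm)) (extChartAt (𝓡 n) c' (u x)) :=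
    ((contDiffAt_comp_symm (by decide) hx hf).fderiv_right (m := 0) (by simp)).continuousAt
  exact h3.comp (f := fun y => extChartAt (𝓡 n) c' (u y))
    (ContinuousAt.comp (g := extChartAt (𝓡 n) c') (mdifferentiableAt_extChartAt' hx).continuousAt hu)

end Coordinates

/-! ### The metric, the Christoffel symbols and the induced connection in a chart -/

section Metric

variable {n : ℕ} {N : Type*}
  [TopologicalSpace N] [ChartedSpace (Model n) N] [IsManifold (𝓡 n) ∞ N]
  [RiemannianBundle (fun y : N => TangentSpace (𝓡 n) y)]
  {c x : N}

variable (n) in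
/-- The Gram form of the metric at `x` in the chart at `c`, as a bilinear form on the model space
(written through its coefficients, which makes its regularity visible). -/
def gramForm (c x : N) : Model n →L[ℝ] Model n →L[ℝ] ℝ :=
  ∑ i, ∑ j, (inner ℝ (coordVec n c x (EuclideanSpace.basisFun (Fin n) ℝ i))
      (coordVec n c x (EuclideanSpace.basisFun (Fin n) ℝ j)) : ℝ) •
    (EuclideanSpace.proj i : Model n →L[ℝ] ℝ).smulRight (EuclideanSpace.proj j : Model n →L[ℝ] ℝ)

theorem gramForm_apply (hx : x ∈ (chartAt (Model n) c).source) (a b : Model n) :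
    gramForm n c x a b = inner ℝ (coordVec n c x a) (coordVec n c x b) := by
  have key : ∀ a : Model n, coordVec n c x a
      = ∑ i, a i • coordVec n c x (EuclideanSpace.basisFun (Fin n) ℝ i) := by
    intro a
    conv_lhs => rw [← (EuclideanSpace.basisFun (Fin n) ℝ).sum_repr a]
    simp only [coordVec_eq hx, EuclideanSpace.basisFun_repr]
    rw [map_sum]
    exact Finset.sum_congr rfl fun i _ => map_smul (coordVecL c x) _ _
  rw [key a, key b, sum_inner]
  simp only [inner_sum, inner_smul_left, inner_smul_right]
  simp only [gramForm, sum_apply, smul_apply,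
    ContinuousLinearMap.smulRight_apply, smul_eq_mul]
  refine Finset.sum_congr rfl fun i _ => Finset.sum_congr rfl fun j _ => ?_
  rw [conj_trivial, show (EuclideanSpace.proj i : Model n →L[ℝ] ℝ) a = a i from rfl,
    show (EuclideanSpace.proj j : Model n →L[ℝ] ℝ) b = b j from rfl]
  ring

theorem gramForm_symm (hx : x ∈ (chartAt (Model n) c).source) (a b : Model n) :
    gramForm n c x a b = gramForm n c x b a := by
  rw [gramForm_apply hx, gramForm_apply hx, real_inner_comm]

theorem inner_eq_gramForm (hx : x ∈ (chartAt (Model n) c).source) (v w : Tang n x) :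
    (inner ℝ v w : ℝ) = gramForm n c x (coordComp n c x v) (coordComp n c x w) := by
  rw [gramForm_apply hx, coordVec_coordComp hx, coordVec_coordComp hx]

theorem contMDiffAt_coordVec (hx : x ∈ (chartAt (Model n) c).source) (a : Model n) :
    ContMDiffAt (𝓡 n) ((𝓡 n).prod 𝓘(ℝ, Model n)) 1 (fun y =>
      (⟨y, coordVec n c y a⟩ : TotalSpace (Model n) (TangentSpace (𝓡 n) : N → Type _))) x := by
  rw [(trivializationAt (Model n) (TangentSpace (𝓡 n) : N → Type _) c).contMDiffAt_iff
    (by rwa [TangentBundle.trivializationAt_source])]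
  refine ⟨contMDiffAt_id, ?_⟩
  refine contMDiffAt_const (c := a) |>.congr_of_eventuallyEq ?_
  filter_upwards [eventually_mem_source hx] with y hy
  exact coordComp_coordVec hy a

variable [IsContMDiffRiemannianBundle (𝓡 n) ∞ (Model n) (fun y : N => TangentSpace (𝓡 n) y)]

theorem contMDiffAt_gramForm (hx : x ∈ (chartAt (Model n) c).source) :
    ContMDiffAt (𝓡 n) 𝓘(ℝ, Model n →L[ℝ] Model n →L[ℝ] ℝ) 1 (gramForm n c) x := by
  unfold gramForm
  refine contMDiffAt_finsetSum fun i _ => contMDiffAt_finsetSum fun j _ => ?_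
  have : IsContMDiffRiemannianBundle (𝓡 n) 1 (Model n) (fun y : N => TangentSpace (𝓡 n) y) :=
    IsContMDiffRiemannianBundle.of_le (n := ∞) (by decide)
  have h : ContMDiffAt (𝓡 n) 𝓘(ℝ, ℝ) 1 (fun y => (inner ℝ
      (coordVec n c y (EuclideanSpace.basisFun (Fin n) ℝ i))
      (coordVec n c y (EuclideanSpace.basisFun (Fin n) ℝ j)) : ℝ)) x :=
    ContMDiffAt.inner_bundle (E := fun y : N => TangentSpace (𝓡 n) y)
      (contMDiffAt_coordVec hx _) (contMDiffAt_coordVec hx _)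
  exact h.smul contMDiffAt_const

theorem dirDeriv_gramForm_symm (hx : x ∈ (chartAt (Model n) c).source) (v : Tang n x)
    (a b : Model n) :
    dirDeriv n (gramForm n c) x v a b = dirDeriv n (gramForm n c) x v b a := by
  have hG := (contMDiffAt_gramForm hx).mdifferentiableAt one_ne_zero
  have key : ∀ a b : Model n, dirDeriv n (fun y => gramForm n c y a b) x v
      = dirDeriv n (gramForm n c) x v a b := by
    intro a b
    rw [dirDeriv_clm_apply (mdifferentiableAt_clm_apply hG mdifferentiableAt_const)
      mdifferentiableAt_const, dirDeriv_clm_apply hG mdifferentiableAt_const]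
    simp
  rw [← key, ← key]
  apply dirDeriv_congr
  filter_upwards [eventually_mem_source hx] with y hy
  exact gramForm_symm hy a b

/-- The derivative of the metric coefficients in the chart at `c`, in the direction `v` and at the
vectors `a`, `b`, which are kept constant in that chart. For `c = x` this is `metricDeriv`. -/
def metricDerivAt (c x : N) (v a b : Tang n x) : ℝ :=
  dirDeriv n (gramForm n c) x v (coordComp n c x a) (coordComp n c x b)

theorem metricDeriv_eq (x : N) (v a b : Tang n x) :
    metricDeriv n x v a b = metricDerivAt x x v a b := by
  have hx := mem_chart_source (Model n) x
  have hG := (contMDiffAt_gramForm hx).mdifferentiableAt one_ne_zero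
  have key : ∀ a b : Model n, dirDeriv n (fun y => gramForm n x y a b) x v
      = dirDeriv n (gramForm n x : N → _) x v a b := by
    intro a b
    rw [dirDeriv_clm_apply (mdifferentiableAt_clm_apply hG mdifferentiableAt_const)
      mdifferentiableAt_const, dirDeriv_clm_apply hG mdifferentiableAt_const]
    simp
  unfold metricDeriv metricDerivAt
  rw [← key]
  apply dirDeriv_congr
  filter_upwards [eventually_mem_source hx] with y hy
  rw [gramForm_apply hy]
  rfl

/-- The Koszul form of the metric in the chart at `c`: the linear form dual to the Christoffel
symbol. -/
def koszulForm (c x : N) (v w z : Tang n x) : ℝ :=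
  (metricDerivAt c x v w z + metricDerivAt c x w v z - metricDerivAt c x z v w) / 2

/-- The Christoffel symbol at `x` of the Levi-Civita connection in the chart at `c`. -/
def christoffelAt (c x : N) (v w : Tang n x) : Tang n x :=
  ∑ k, koszulForm c x v w (frame n x k) • frame n x k

theorem christoffel_eq (x : N) (v w : Tang n x) :
    christoffel n x v w = christoffelAt x x v w := by
  simp only [christoffel, christoffelAt, koszulForm, metricDeriv_eq]

/-- The Levi-Civita connection is torsion free. -/
theorem koszulForm_comm (hx : x ∈ (chartAt (Model n) c).source) (v w z : Tang n x) :
    koszulForm c x v w z = koszulForm c x w v z := by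
  unfold koszulForm metricDerivAt
  rw [dirDeriv_gramForm_symm hx z (coordComp n c x w)]
  ring

theorem inner_christoffelAt (hx : x ∈ (chartAt (Model n) c).source) (v w z : Tang n x) :
    (inner ℝ (christoffelAt c x v w) z : ℝ) = koszulForm c x v w z := by
  let K : Tang n x →ₗ[ℝ] ℝ :=
    { toFun := koszulForm c x v w
      map_add' := fun a b => by
        simp only [koszulForm, metricDerivAt, coordComp_add hx, map_add, dirDeriv_dir_add,
          add_apply]
        ring
      map_smul' := fun r a => by
        simp only [koszulForm, metricDerivAt, coordComp_smul hx, map_smul, dirDeriv_dir_smul,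
          smul_apply, smul_eq_mul, RingHom.id_apply]
        ring }
  have h1 : koszulForm c x v w z = K (∑ k, (inner ℝ (frame n x k) z : ℝ) • frame n x k) := by
    rw [OrthonormalBasis.sum_repr' (frame n x) z]
    rfl
  rw [h1, map_sum, christoffelAt, sum_inner]
  refine Finset.sum_congr rfl fun k _ => ?_
  rw [map_smul, inner_smul_left, smul_eq_mul, conj_trivial, mul_comm]
  rfl

theorem christoffelAt_comm (hx : x ∈ (chartAt (Model n) c).source) (v w : Tang n x) :
    christoffelAt c x v w = christoffelAt c x w v :=
  ext_inner_right ℝ fun z => by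
    rw [inner_christoffelAt hx, inner_christoffelAt hx, koszulForm_comm hx]

/-- The Levi-Civita connection is compatible with the metric. -/
theorem koszulForm_add_koszulForm (hx : x ∈ (chartAt (Model n) c).source) (v w z : Tang n x) :
    koszulForm c x v w z + koszulForm c x v z w = metricDerivAt c x v w z := by
  unfold koszulForm metricDerivAt
  rw [dirDeriv_gramForm_symm hx v (coordComp n c x z)]
  ring

end Metric

section Connection

variable {m n : ℕ} {M N : Type*}
  [TopologicalSpace M] [ChartedSpace (Model m) M] [IsManifold (𝓡 m) ∞ M]
  [TopologicalSpace N] [ChartedSpace (Model n) N] [IsManifold (𝓡 n) ∞ N]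
  {u : M → N} {x : M} {c : N}

variable (m n) in
/-- `W` is a `C¹` section of `u⁻¹TN` at `x`. For `u = id` it is a `C¹` vector field. -/
def IsC1Section (u : M → N) (W : ∀ y : M, Tang n (u y)) (x : M) : Prop :=
  ContMDiffAt (𝓡 m) ((𝓡 n).prod 𝓘(ℝ, Model n)) 1 (fun y =>
    (⟨u y, W y⟩ : TotalSpace (Model n) (TangentSpace (𝓡 n) : N → Type _))) x

theorem isC1Section_iff (hx : u x ∈ (chartAt (Model n) c).source)
    (hu : ContMDiffAt (𝓡 m) (𝓡 n) ∞ u x) {W : ∀ y : M, Tang n (u y)} :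
    IsC1Section m n u W x ↔ ContMDiffAt (𝓡 m) 𝓘(ℝ, Model n) 1
      (fun y => coordComp n c (u y) (W y)) x := by
  unfold IsC1Section
  rw [(trivializationAt (Model n) (TangentSpace (𝓡 n) : N → Type _) c).contMDiffAt_iff
    (by rwa [TangentBundle.trivializationAt_source])]
  exact ⟨fun h => h.2, fun h => ⟨hu.of_le (by decide), h⟩⟩

theorem IsC1Section.coordComp {W : ∀ y : M, Tang n (u y)} (hW : IsC1Section m n u W x)
    (hx : u x ∈ (chartAt (Model n) c).source) :
    ContMDiffAt (𝓡 m) 𝓘(ℝ, Model n) 1 (fun y => coordComp n c (u y) (W y)) x := by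
  unfold IsC1Section at hW
  rw [(trivializationAt (Model n) (TangentSpace (𝓡 n) : N → Type _) c).contMDiffAt_iff
    (by rwa [TangentBundle.trivializationAt_source])] at hW
  exact hW.2

theorem IsC1Section.congr {W Z : ∀ y : M, Tang n (u y)} (hW : IsC1Section m n u W x)
    (h : ∀ᶠ y in 𝓝 x, Z y = W y) : IsC1Section m n u Z x :=
  ContMDiffAt.congr_of_eventuallyEq hW (h.mono fun y hy => by simp only [hy])

theorem IsC1Section.eventually {W : ∀ y : M, Tang n (u y)} (hW : IsC1Section m n u W x) :
    ∀ᶠ y in 𝓝 x, IsC1Section m n u W y :=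
  (contMDiffAt_iff_contMDiffAt_nhds (by simp)).1 hW

theorem eventually_map_mem_source (hx : u x ∈ (chartAt (Model n) c).source)
    (hu : ContinuousAt u x) : ∀ᶠ y in 𝓝 x, u y ∈ (chartAt (Model n) c).source :=
  hu.eventually (eventually_mem_source hx)

theorem IsC1Section.add (hu : ContMDiffAt (𝓡 m) (𝓡 n) ∞ u x) {W Z : ∀ y : M, Tang n (u y)}
    (hW : IsC1Section m n u W x) (hZ : IsC1Section m n u Z x) :
    IsC1Section m n u (fun y => W y + Z y) x := by
  have hx := mem_chart_source (Model n) (u x)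
  rw [isC1Section_iff hx hu] at *
  refine (hW.add hZ).congr_of_eventuallyEq ?_
  filter_upwards [eventually_map_mem_source hx hu.continuousAt] with y hy
  exact coordComp_add hy _ _

theorem IsC1Section.smul (hu : ContMDiffAt (𝓡 m) (𝓡 n) ∞ u x) {W : ∀ y : M, Tang n (u y)}
    (hW : IsC1Section m n u W x) {f : M → ℝ} (hf : ContMDiffAt (𝓡 m) 𝓘(ℝ, ℝ) 1 f x) :
    IsC1Section m n u (fun y => f y • W y) x := by
  have hx := mem_chart_source (Model n) (u x)
  rw [isC1Section_iff hx hu] at *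
  refine (hf.smul hW).congr_of_eventuallyEq ?_
  filter_upwards [eventually_map_mem_source hx hu.continuousAt] with y hy
  exact coordComp_smul hy _ _

theorem isC1Section_zero (hu : ContMDiffAt (𝓡 m) (𝓡 n) ∞ u x) :
    IsC1Section m n u (fun _ => 0) x := by
  have hx := mem_chart_source (Model n) (u x)
  rw [isC1Section_iff hx hu]
  refine (contMDiffAt_const (c := 0)).congr_of_eventuallyEq ?_
  filter_upwards [eventually_map_mem_source hx hu.continuousAt] with y hy
  rw [coordComp_eq hy]
  exact map_zero _

theorem isC1Section_sum (hu : ContMDiffAt (𝓡 m) (𝓡 n) ∞ u x) {ι : Type*} (s : Finset ι)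
    {W : ι → ∀ y : M, Tang n (u y)} (hW : ∀ i ∈ s, IsC1Section m n u (W i) x) :
    IsC1Section m n u (fun y => ∑ i ∈ s, W i y) x := by
  classical
  induction s using Finset.induction_on with
  | empty => simpa using isC1Section_zero hu
  | insert a s ha ih =>
    simp only [Finset.sum_insert ha]
    exact (hW a (Finset.mem_insert_self a s)).add hu
      (ih fun i hi => hW i (Finset.mem_insert_of_mem hi))

theorem isC1Section_coordVec_comp (hx : u x ∈ (chartAt (Model n) c).source)
    (hu : ContMDiffAt (𝓡 m) (𝓡 n) ∞ u x) (a : Model n) :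
    IsC1Section m n u (fun y => coordVec n c (u y) a) x := by
  rw [isC1Section_iff hx hu]
  refine (contMDiffAt_const (c := a)).congr_of_eventuallyEq ?_
  filter_upwards [eventually_map_mem_source hx hu.continuousAt] with y hy
  exact coordComp_coordVec hy a

theorem IsC1Section.du (hu : ContMDiff (𝓡 m) (𝓡 n) ∞ u) {Y : ∀ y : M, Tang m y}
    (hY : IsC1Section m m id Y x) : IsC1Section m n u (fun y => du m n u y (Y y)) x := by
  have hx := mem_chart_source (Model m) x
  have hx' := mem_chart_source (Model n) (u x)
  rw [isC1Section_iff hx' hu.contMDiffAt]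
  refine ((contMDiffAt_duCoord hx hx' hu.contMDiffAt).clm_apply
    (hY.coordComp hx)).congr_of_eventuallyEq ?_
  filter_upwards [eventually_mem_source hx,
    eventually_map_mem_source hx' hu.continuous.continuousAt] with y hy hy'
  exact coordComp_du hy hy' hu.contMDiffAt _

end Connection

/-! ### Independence of the chart and compatibility with the metric -/

section ChartChange

variable {n : ℕ} {N : Type*}
  [TopologicalSpace N] [ChartedSpace (Model n) N] [IsManifold (𝓡 n) ∞ N]
  [RiemannianBundle (fun y : N => TangentSpace (𝓡 n) y)]
  {c c' x : N}

theorem du_id (x : N) (v : Tang n x) : du n n id x v = v :=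
  congrArg (fun L : Model n →L[ℝ] Model n => L v) (mfderiv_id (I := 𝓡 n) (x := x))

theorem coordComp_change (hx : x ∈ (chartAt (Model n) c).source)
    (hx' : x ∈ (chartAt (Model n) c').source) (v : Tang n x) :
    coordComp n c' x v = duCoord n n c c' id x (coordComp n c x v) := by
  have h := coordComp_du (u := (id : N → N)) hx hx' contMDiffAt_id v
  rw [du_id] at h
  exact h

variable [IsContMDiffRiemannianBundle (𝓡 n) ∞ (Model n) (fun y : N => TangentSpace (𝓡 n) y)]

/-- The first derivatives of the metric coefficients in two charts differ by terms with the second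
derivatives of the change of charts. -/
theorem metricDerivAt_change (hx : x ∈ (chartAt (Model n) c).source)
    (hx' : x ∈ (chartAt (Model n) c').source) (v a b : Tang n x) :
    metricDerivAt c x v a b = metricDerivAt c' x v a b
      + gramForm n c' x (dirDeriv n (duCoord n n c c' id) x v (coordComp n c x a))
          (coordComp n c' x b)
      + gramForm n c' x (dirDeriv n (duCoord n n c c' id) x v (coordComp n c x b))
          (coordComp n c' x a) := by
  have hG := (contMDiffAt_gramForm hx).mdifferentiableAt one_ne_zero
  have hG' := (contMDiffAt_gramForm hx').mdifferentiableAt one_ne_zero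
  have hA := (contMDiffAt_duCoord (u := (id : N → N)) hx hx' contMDiffAt_id).mdifferentiableAt
    one_ne_zero
  have key : ∀ α β : Model n, dirDeriv n (gramForm n c) x v α β
      = dirDeriv n (fun y => gramForm n c' y (duCoord n n c c' id y α)
          (duCoord n n c c' id y β)) x v := by
    intro α β
    have h1 : dirDeriv n (fun y => gramForm n c y α β) x v
        = dirDeriv n (gramForm n c) x v α β := by
      rw [dirDeriv_clm_apply (mdifferentiableAt_clm_apply hG mdifferentiableAt_const)
        mdifferentiableAt_const, dirDeriv_clm_apply hG mdifferentiableAt_const]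
      simp
    rw [← h1]
    apply dirDeriv_congr
    filter_upwards [eventually_mem_source hx, eventually_mem_source hx'] with y hy hy'
    have h2 : ∀ α : Model n, coordComp n c' y (coordVec n c y α) = duCoord n n c c' id y α :=
      fun α => by rw [coordComp_change hy hy', coordComp_coordVec hy]
    rw [gramForm_apply hy, inner_eq_gramForm hy', h2, h2]
  have hAa : ∀ α : Model n, MDifferentiableAt (𝓡 n) 𝓘(ℝ, Model n)
      (fun y => duCoord n n c c' id y α) x := fun α =>
    mdifferentiableAt_clm_apply hA mdifferentiableAt_const
  have hdA : ∀ α : Model n, dirDeriv n (fun y => duCoord n n c c' id y α) x v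
      = dirDeriv n (duCoord n n c c' id) x v α := fun α => by
    rw [dirDeriv_clm_apply hA mdifferentiableAt_const]
    simp
  unfold metricDerivAt
  rw [key, dirDeriv_clm_apply (mdifferentiableAt_clm_apply hG' (hAa _)) (hAa _),
    dirDeriv_clm_apply hG' (hAa _), hdA, hdA, ← coordComp_change hx hx',
    ← coordComp_change hx hx', add_apply, gramForm_symm hx' (coordComp n c' x a)]

/-- The transformation law of the Christoffel symbols under a change of charts. -/
theorem christoffelAt_change (hx : x ∈ (chartAt (Model n) c).source)
    (hx' : x ∈ (chartAt (Model n) c').source) (v w : Tang n x) :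
    christoffelAt c x v w
      = coordVec n c' x (dirDeriv n (duCoord n n c c' id) x v (coordComp n c x w))
        + christoffelAt c' x v w := by
  refine ext_inner_right ℝ fun z => ?_
  -- By this symmetry, four of the six second-derivative terms of the Koszul form cancel.
  have hs := dirDeriv_duCoord_symm (u := (id : N → N)) hx hx' contMDiffAt_id
  rw [inner_add_left, inner_christoffelAt hx, inner_christoffelAt hx',
    inner_eq_gramForm hx' (coordVec n c' x _) z, coordComp_coordVec hx']
  unfold koszulForm
  rw [metricDerivAt_change hx hx', metricDerivAt_change hx hx', metricDerivAt_change hx hx',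
    hs w v, hs z v, hs z w]
  ring

end ChartChange

section Connection

variable {m n : ℕ} {M N : Type*}
  [TopologicalSpace M] [ChartedSpace (Model m) M] [IsManifold (𝓡 m) ∞ M]
  [TopologicalSpace N] [ChartedSpace (Model n) N] [IsManifold (𝓡 n) ∞ N]
  [RiemannianBundle (fun y : N => TangentSpace (𝓡 n) y)]
  [IsContMDiffRiemannianBundle (𝓡 n) ∞ (Model n) (fun y : N => TangentSpace (𝓡 n) y)]
  {u : M → N} {x : M} {c : N}

variable (m n) in
/-- The connection on `u⁻¹TN`, written in the chart at `c` of `N`. -/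
def connAt (c : N) (u : M → N) (W : ∀ y : M, Tang n (u y)) (x : M) (v : Tang m x) :
    Tang n (u x) :=
  coordVec n c (u x) (dirDeriv m (fun y => coordComp n c (u y) (W y)) x v)
    + christoffelAt c (u x) (du m n u x v) (W x)

/-- The induced connection may be computed in any chart of `N`. -/
theorem pullbackConn_eq_connAt (hu : ContMDiffAt (𝓡 m) (𝓡 n) ∞ u x)
    (hx : u x ∈ (chartAt (Model n) c).source) {W : ∀ y : M, Tang n (u y)}
    (hW : IsC1Section m n u W x) (v : Tang m x) :
    pullbackConn m n u W x v = connAt m n c u W x v := by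
  have hx' := mem_chart_source (Model n) (u x)
  have hA := (contMDiffAt_duCoord (u := (id : N → N)) hx hx' contMDiffAt_id).mdifferentiableAt
    one_ne_zero
  have hum := hu.mdifferentiableAt (by simp)
  have hWc := (hW.coordComp hx).mdifferentiableAt one_ne_zero
  have h1 : (fun y => coordComp n (u x) (u y) (W y)) =ᶠ[𝓝 x]
      fun y => duCoord n n c (u x) id (u y) (coordComp n c (u y) (W y)) := by
    filter_upwards [eventually_map_mem_source hx hu.continuousAt,
      eventually_map_mem_source hx' hu.continuousAt] with y hy hy'
    exact coordComp_change hy hy' _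
  have h2 : coordVec n (u x) (u x) (duCoord n n c (u x) id (u x)
      (dirDeriv m (fun y => coordComp n c (u y) (W y)) x v))
      = coordVec n c (u x) (dirDeriv m (fun y => coordComp n c (u y) (W y)) x v) := by
    have h3 := coordComp_change hx hx'
      (coordVec n c (u x) (dirDeriv m (fun y => coordComp n c (u y) (W y)) x v))
    rw [coordComp_coordVec hx] at h3
    rw [← h3, coordVec_coordComp hx']
  have hAu : MDifferentiableAt (𝓡 m) 𝓘(ℝ, Model n →L[ℝ] Model n)
      (fun y => duCoord n n c (u x) id (u y)) x := mdifferentiableAt_comp_map hA hum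
  unfold pullbackConn connAt
  rw [dirDeriv_congr h1, dirDeriv_clm_apply hAu hWc, dirDeriv_comp_map hA hum,
    coordVec_add hx', h2, christoffel_eq, christoffelAt_change hx hx']
  abel

theorem contMDiffAt_inner {W Z : ∀ y : M, Tang n (u y)}
    (hW : IsC1Section m n u W x) (hZ : IsC1Section m n u Z x) :
    ContMDiffAt (𝓡 m) 𝓘(ℝ, ℝ) 1 (fun y => (inner ℝ (W y) (Z y) : ℝ)) x := by
  have : IsContMDiffRiemannianBundle (𝓡 n) 1 (Model n) (fun y : N => TangentSpace (𝓡 n) y) :=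
    IsContMDiffRiemannianBundle.of_le (n := ∞) (by decide)
  exact ContMDiffAt.inner_bundle (E := fun y : N => TangentSpace (𝓡 n) y) hW hZ

/-- The induced connection is compatible with the metric. -/
theorem dirDeriv_inner (hu : ContMDiffAt (𝓡 m) (𝓡 n) ∞ u x) {W Z : ∀ y : M, Tang n (u y)}
    (hW : IsC1Section m n u W x) (hZ : IsC1Section m n u Z x) (v : Tang m x) :
    dirDeriv m (fun y => (inner ℝ (W y) (Z y) : ℝ)) x v
      = inner ℝ (pullbackConn m n u W x v) (Z x) + inner ℝ (W x) (pullbackConn m n u Z x v) := by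
  have hx := mem_chart_source (Model n) (u x)
  have hum := hu.mdifferentiableAt (by simp)
  have hWc := (hW.coordComp hx).mdifferentiableAt one_ne_zero
  have hZc := (hZ.coordComp hx).mdifferentiableAt one_ne_zero
  have hG := (contMDiffAt_gramForm hx).mdifferentiableAt one_ne_zero
  have hGu : MDifferentiableAt (𝓡 m) 𝓘(ℝ, Model n →L[ℝ] Model n →L[ℝ] ℝ)
      (fun y => gramForm n (u x) (u y)) x := mdifferentiableAt_comp_map hG hum
  have h1 : (fun y => (inner ℝ (W y) (Z y) : ℝ)) =ᶠ[𝓝 x]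
      fun y => gramForm n (u x) (u y) (coordComp n (u x) (u y) (W y))
        (coordComp n (u x) (u y) (Z y)) := by
    filter_upwards [eventually_map_mem_source hx hu.continuousAt] with y hy
    exact inner_eq_gramForm hy _ _
  rw [pullbackConn_eq_connAt hu hx hW, pullbackConn_eq_connAt hu hx hZ, dirDeriv_congr h1,
    dirDeriv_clm_apply (mdifferentiableAt_clm_apply hGu hWc) hZc, dirDeriv_clm_apply hGu hWc,
    dirDeriv_comp_map hG hum]
  unfold connAt
  rw [inner_add_left, inner_add_right, inner_christoffelAt hx,
    real_inner_comm (christoffelAt (u x) (u x) (du m n u x v) (Z x)) (W x),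
    inner_christoffelAt hx, inner_eq_gramForm hx (coordVec n (u x) (u x) _) (Z x),
    inner_eq_gramForm hx (W x) (coordVec n (u x) (u x) _), coordComp_coordVec hx,
    coordComp_coordVec hx, add_apply]
  have h2 := koszulForm_add_koszulForm hx (du m n u x v) (W x) (Z x)
  unfold metricDerivAt at h2
  rw [← h2]
  ring

theorem christoffel_add (x : N) (v w w' : Tang n x) :
    christoffel n x v (w + w') = christoffel n x v w + christoffel n x v w' := by
  have hx := mem_chart_source (Model n) x
  refine ext_inner_right ℝ fun z => ?_
  simp only [christoffel_eq, inner_add_left, inner_christoffelAt hx, koszulForm, metricDerivAt,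
    coordComp_add hx, map_add, dirDeriv_dir_add, add_apply]
  ring

theorem christoffel_smul (x : N) (v w : Tang n x) (r : ℝ) :
    christoffel n x v (r • w) = r • christoffel n x v w := by
  have hx := mem_chart_source (Model n) x
  refine ext_inner_right ℝ fun z => ?_
  simp only [christoffel_eq, inner_smul_left, inner_christoffelAt hx, koszulForm, metricDerivAt,
    coordComp_smul hx, map_smul, dirDeriv_dir_smul, smul_apply, smul_eq_mul, conj_trivial]
  ring

theorem christoffel_comm (x : N) (v w : Tang n x) :
    christoffel n x v w = christoffel n x w v := by
  rw [christoffel_eq, christoffel_eq, christoffelAt_comm (mem_chart_source (Model n) x)]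

theorem pullbackConn_congr {W Z : ∀ y : M, Tang n (u y)} (h : ∀ᶠ y in 𝓝 x, W y = Z y)
    (v : Tang m x) : pullbackConn m n u W x v = pullbackConn m n u Z x v := by
  unfold pullbackConn
  have h1 : (fun y => coordComp n (u x) (u y) (W y)) =ᶠ[𝓝 x]
      fun y => coordComp n (u x) (u y) (Z y) := h.mono fun y hy => by simp only [hy]
  rw [dirDeriv_congr h1, h.self_of_nhds]

theorem pullbackConn_add (hu : ContMDiffAt (𝓡 m) (𝓡 n) ∞ u x) {W Z : ∀ y : M, Tang n (u y)}
    (hW : IsC1Section m n u W x) (hZ : IsC1Section m n u Z x) (v : Tang m x) :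
    pullbackConn m n u (fun y => W y + Z y) x v
      = pullbackConn m n u W x v + pullbackConn m n u Z x v := by
  have hx := mem_chart_source (Model n) (u x)
  have h1 : (fun y => coordComp n (u x) (u y) (W y + Z y)) =ᶠ[𝓝 x]
      fun y => coordComp n (u x) (u y) (W y) + coordComp n (u x) (u y) (Z y) := by
    filter_upwards [eventually_map_mem_source hx hu.continuousAt] with y hy
    exact coordComp_add hy _ _
  unfold pullbackConn
  rw [dirDeriv_congr h1, dirDeriv_add ((hW.coordComp hx).mdifferentiableAt one_ne_zero)
    ((hZ.coordComp hx).mdifferentiableAt one_ne_zero), coordVec_add hx, christoffel_add]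
  abel

/-- The Leibniz rule for the induced connection. -/
theorem pullbackConn_smul (hu : ContMDiffAt (𝓡 m) (𝓡 n) ∞ u x) {W : ∀ y : M, Tang n (u y)}
    (hW : IsC1Section m n u W x) {f : M → ℝ} (hf : ContMDiffAt (𝓡 m) 𝓘(ℝ, ℝ) 1 f x)
    (v : Tang m x) :
    pullbackConn m n u (fun y => f y • W y) x v
      = dirDeriv m f x v • W x + f x • pullbackConn m n u W x v := by
  have hx := mem_chart_source (Model n) (u x)
  have h1 : (fun y => coordComp n (u x) (u y) (f y • W y)) =ᶠ[𝓝 x]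
      fun y => f y • coordComp n (u x) (u y) (W y) := by
    filter_upwards [eventually_map_mem_source hx hu.continuousAt] with y hy
    exact coordComp_smul hy _ _
  unfold pullbackConn
  rw [dirDeriv_congr h1, dirDeriv_smul (hf.mdifferentiableAt one_ne_zero)
    ((hW.coordComp hx).mdifferentiableAt one_ne_zero), coordVec_add hx, coordVec_smul hx,
    coordVec_smul hx, coordVec_coordComp hx, christoffel_smul, smul_add, add_assoc]

theorem pullbackConn_sum (hu : ContMDiffAt (𝓡 m) (𝓡 n) ∞ u x) {ι : Type*} (s : Finset ι)
    {W : ι → ∀ y : M, Tang n (u y)} (hW : ∀ i ∈ s, IsC1Section m n u (W i) x) (v : Tang m x) :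
    pullbackConn m n u (fun y => ∑ i ∈ s, W i y) x v
      = ∑ i ∈ s, pullbackConn m n u (W i) x v := by
  classical
  induction s using Finset.induction_on with
  | empty =>
    have h := pullbackConn_smul (f := fun _ => (0 : ℝ)) hu (isC1Section_zero hu)
      contMDiffAt_const v
    simpa using h
  | insert a s ha ih =>
    simp only [Finset.sum_insert ha]
    have hW' : ∀ i ∈ s, IsC1Section m n u (W i) x := fun i hi => hW i (Finset.mem_insert_of_mem hi)
    rw [pullbackConn_add hu (hW a (Finset.mem_insert_self a s)) (isC1Section_sum hu s hW'), ih hW']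

theorem pullbackConn_dir_add (W : ∀ y : M, Tang n (u y)) (v w : Tang m x) :
    pullbackConn m n u W x (v + w) = pullbackConn m n u W x v + pullbackConn m n u W x w := by
  have hx := mem_chart_source (Model n) (u x)
  unfold pullbackConn
  rw [dirDeriv_dir_add, coordVec_add hx, map_add, christoffel_comm, christoffel_add,
    christoffel_comm _ (W x), christoffel_comm _ (W x)]
  abel

theorem pullbackConn_dir_smul (W : ∀ y : M, Tang n (u y)) (r : ℝ) (v : Tang m x) :
    pullbackConn m n u W x (r • v) = r • pullbackConn m n u W x v := by
  have hx := mem_chart_source (Model n) (u x)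
  unfold pullbackConn
  rw [dirDeriv_dir_smul, coordVec_smul hx, map_smul, christoffel_comm, christoffel_smul,
    christoffel_comm _ (W x), smul_add]

variable [RiemannianBundle (fun x : M => TangentSpace (𝓡 m) x)]
  [IsContMDiffRiemannianBundle (𝓡 m) ∞ (Model m) (fun x : M => TangentSpace (𝓡 m) x)]

/-- The Levi-Civita connection is the connection induced by the identity map. -/
theorem leviCivita_eq (Y : ∀ y : M, Tang m y) (x : M) (v : Tang m x) :
    leviCivita m Y x v = pullbackConn m m id Y x v := by
  unfold leviCivita pullbackConn
  rw [du_id]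
  rfl

theorem coordComp_du_coordField (hu : ContMDiff (𝓡 m) (𝓡 n) ∞ u) (w : Tang m x) :
    (fun y => coordComp n (u x) (u y) (du m n u y (coordField m x w y))) =ᶠ[𝓝 x]
      fun y => duCoord m n x (u x) u y (coordComp m x x w) := by
  have hx := mem_chart_source (Model m) x
  have hx' := mem_chart_source (Model n) (u x)
  filter_upwards [eventually_mem_source hx,
    eventually_map_mem_source hx' hu.continuous.continuousAt] with y hy hy'
  rw [coordComp_du hy hy' hu.contMDiffAt, coordField, coordComp_coordVec hy]

theorem leviCivita_coordField (v w : Tang m x) :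
    leviCivita m (coordField m x w) x v = christoffel m x v w := by
  have hx := mem_chart_source (Model m) x
  have h1 : (fun y => coordComp m x y (coordField m x w y)) =ᶠ[𝓝 x]
      fun _ => coordComp m x x w := by
    filter_upwards [eventually_mem_source hx] with y hy
    exact coordComp_coordVec hy _
  unfold leviCivita
  rw [dirDeriv_congr h1, dirDeriv_const, coordVec_eq hx, map_zero, zero_add]
  unfold coordField
  rw [coordVec_coordComp hx]

theorem coordField_self (v : Tang m x) : coordField m x v x = v :=
  coordVec_coordComp (mem_chart_source (Model m) x) v

/-- The second fundamental form `∇du` of a smooth map is symmetric: in charts this is the symmetry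
of second derivatives and of Christoffel symbols. -/
theorem secondFundamentalForm_symm (hu : ContMDiff (𝓡 m) (𝓡 n) ∞ u) (v w : Tang m x) :
    pullbackConn m n u (fun y => du m n u y (coordField m x w y)) x v
        - du m n u x (leviCivita m (coordField m x w) x v)
      = pullbackConn m n u (fun y => du m n u y (coordField m x v y)) x w
        - du m n u x (leviCivita m (coordField m x v) x w) := by
  have hx := mem_chart_source (Model m) x
  have hx' := mem_chart_source (Model n) (u x)
  have hU := (contMDiffAt_duCoord hx hx' hu.contMDiffAt).mdifferentiableAt one_ne_zero
  unfold pullbackConn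
  rw [dirDeriv_congr (coordComp_du_coordField hu w), dirDeriv_congr (coordComp_du_coordField hu v),
    leviCivita_coordField, leviCivita_coordField,
    dirDeriv_clm_apply hU mdifferentiableAt_const, dirDeriv_clm_apply hU mdifferentiableAt_const,
    dirDeriv_duCoord_symm hx hx' hu.contMDiffAt v w]
  simp only [coordField_self, dirDeriv_const]
  rw [christoffel_comm x v w, christoffel_comm (u x) (du m n u x v)]

end Connection

/-! ### Traces and smooth orthonormal frames -/

section Trace

variable {E V ι κ : Type*} [NormedAddCommGroup E] [InnerProductSpace ℝ E]
  [AddCommGroup V] [Module ℝ V] [Fintype ι] [Fintype κ]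

/-- The trace of a bilinear map does not depend on the orthonormal basis. -/
theorem sum_bilin_eq_of_orthonormalBasis (b : OrthonormalBasis ι ℝ E)
    (b' : OrthonormalBasis κ ℝ E) (f : E →ₗ[ℝ] E →ₗ[ℝ] V) :
    ∑ i, f (b i) (b i) = ∑ j, f (b' j) (b' j) := by
  have h1 : ∀ i, f (b i) (b i) = ∑ j, (inner ℝ (b' j) (b i) : ℝ) • f (b' j) (b i) := by
    intro i
    have h : f (b i) (b i) = f (∑ j, (inner ℝ (b' j) (b i) : ℝ) • b' j) (b i) := by
      rw [b'.sum_repr']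
    rw [h, map_sum, LinearMap.sum_apply]
    simp only [map_smul, LinearMap.smul_apply]
  have h2 : ∀ j, f (b' j) (b' j) = ∑ i, (inner ℝ (b i) (b' j) : ℝ) • f (b' j) (b i) := by
    intro j
    have h : f (b' j) (b' j) = f (b' j) (∑ i, (inner ℝ (b i) (b' j) : ℝ) • b i) := by
      rw [b.sum_repr']
    rw [h, map_sum]
    simp only [map_smul]
  simp only [h1, h2]
  rw [Finset.sum_comm]
  simp only [real_inner_comm]

theorem sum_inner_smul_eq_of_orthonormalBasis {H : Type*} [NormedAddCommGroup H]
    [InnerProductSpace ℝ H] (b : OrthonormalBasis ι ℝ E) (b' : OrthonormalBasis κ ℝ E)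
    {L : E → H} (hadd : ∀ a c, L (a + c) = L a + L c) (hsmul : ∀ (r : ℝ) a, L (r • a) = r • L a)
    (w : H) :
    ∑ i, (inner ℝ w (L (b i)) : ℝ) • L (b i) = ∑ j, (inner ℝ w (L (b' j)) : ℝ) • L (b' j) :=
  sum_bilin_eq_of_orthonormalBasis b b' (LinearMap.mk₂ ℝ
    (fun a c => (inner ℝ w (L a) : ℝ) • L c)
    (fun a a' c => by simp only [hadd, inner_add_right, add_smul])
    (fun r a c => by simp only [hsmul, inner_smul_right, mul_smul])
    (fun a c c' => by simp only [hadd, smul_add])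
    (fun r a c => by simp only [hsmul, smul_comm r]))

theorem sum_inner_eq_of_orthonormalBasis {H : Type*} [NormedAddCommGroup H]
    [InnerProductSpace ℝ H] (b : OrthonormalBasis ι ℝ E) (b' : OrthonormalBasis κ ℝ E)
    {S L : E → H} (hSadd : ∀ a c, S (a + c) = S a + S c)
    (hSsmul : ∀ (r : ℝ) a, S (r • a) = r • S a) (hadd : ∀ a c, L (a + c) = L a + L c)
    (hsmul : ∀ (r : ℝ) a, L (r • a) = r • L a) :
    ∑ i, (inner ℝ (S (b i)) (L (b i)) : ℝ) = ∑ j, (inner ℝ (S (b' j)) (L (b' j)) : ℝ) :=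
  sum_bilin_eq_of_orthonormalBasis b b' (LinearMap.mk₂ ℝ
    (fun a c => (inner ℝ (S a) (L c) : ℝ))
    (fun a a' c => by simp only [hSadd, inner_add_left])
    (fun r a c => by simp only [hSsmul, inner_smul_left, conj_trivial, smul_eq_mul])
    (fun a c c' => by simp only [hadd, inner_add_right])
    (fun r a c => by simp only [hsmul, inner_smul_right, smul_eq_mul]))

theorem linearIndependent_of_apply_eq_basisFun {m : ℕ} {v : Fin m → E} (L : E →ₗ[ℝ] Model m)
    (h : ∀ j, L (v j) = EuclideanSpace.basisFun (Fin m) ℝ j) : LinearIndependent ℝ v := by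
  refine LinearIndependent.of_comp L ?_
  have h2 : L ∘ v = (EuclideanSpace.basisFun (Fin m) ℝ).toBasis := by
    funext j
    rw [OrthonormalBasis.coe_toBasis]
    exact h j
  rw [h2]
  exact (EuclideanSpace.basisFun (Fin m) ℝ).toBasis.linearIndependent

theorem exists_orthonormalBasis_eq_gramSchmidtNormed [FiniteDimensional ℝ E] {m : ℕ} {v : Fin m → E}
    (hv : LinearIndependent ℝ v) (hE : Module.finrank ℝ E = m) :
    ∃ b : OrthonormalBasis (Fin m) ℝ E,
      ∀ i, b i = InnerProductSpace.gramSchmidtNormed ℝ v i := by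
  have h := InnerProductSpace.gramSchmidtNormed_orthonormal hv
  refine ⟨OrthonormalBasis.mk h
    (h.linearIndependent.span_eq_top_of_card_eq_finrank' (by simp [hE])).ge, fun i => ?_⟩
  rw [OrthonormalBasis.coe_mk]

end Trace

section Frame

variable {m : ℕ} {M : Type*}
  [TopologicalSpace M] [ChartedSpace (Model m) M] [IsManifold (𝓡 m) ∞ M]
  [RiemannianBundle (fun x : M => TangentSpace (𝓡 m) x)]
  {c x : M}

/-- The orthonormal frame obtained from the coordinate frame of the chart at `c` by the
Gram-Schmidt process. -/
def orthoFrame (c : M) (i : Fin m) (y : M) : Tang m y :=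
  InnerProductSpace.gramSchmidtNormed ℝ
    (fun j => coordVec m c y (EuclideanSpace.basisFun (Fin m) ℝ j)) i

/-- `coordComp` as a linear map, for the vector space structure underlying the Riemannian metric. -/
def coordCompₗ (hx : x ∈ (chartAt (Model m) c).source) : Tang m x →ₗ[ℝ] Model m where
  toFun := coordComp m c x
  map_add' := coordComp_add hx
  map_smul' := coordComp_smul hx

theorem gramSchmidt_coordVec_ne_zero (hx : x ∈ (chartAt (Model m) c).source) (i : Fin m) :
    InnerProductSpace.gramSchmidt ℝ
      (fun j => coordVec m c x (EuclideanSpace.basisFun (Fin m) ℝ j)) i ≠ 0 :=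
  InnerProductSpace.gramSchmidt_ne_zero i (linearIndependent_of_apply_eq_basisFun (coordCompₗ hx)
    fun _ => coordComp_coordVec hx _)

theorem exists_orthonormalBasis_eq_orthoFrame (hx : x ∈ (chartAt (Model m) c).source) :
    ∃ b : OrthonormalBasis (Fin m) ℝ (Tang m x), ∀ i, b i = orthoFrame c i x :=
  exists_orthonormalBasis_eq_gramSchmidtNormed
    (linearIndependent_of_apply_eq_basisFun (coordCompₗ hx) fun _ => coordComp_coordVec hx _)
    (show Module.finrank ℝ (Model m) = m from finrank_euclideanSpace_fin)

/-- The orthonormal frame of the chart at `c`, as an orthonormal basis of `T_x M`. -/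
def orthoBasis (hx : x ∈ (chartAt (Model m) c).source) : OrthonormalBasis (Fin m) ℝ (Tang m x) :=
  (exists_orthonormalBasis_eq_orthoFrame hx).choose

theorem orthoBasis_apply (hx : x ∈ (chartAt (Model m) c).source) (i : Fin m) :
    orthoBasis hx i = orthoFrame c i x :=
  (exists_orthonormalBasis_eq_orthoFrame hx).choose_spec i

theorem sum_inner_orthoFrame (hx : x ∈ (chartAt (Model m) c).source) (v : Tang m x) :
    ∑ i, (inner ℝ (orthoFrame c i x) v : ℝ) • orthoFrame c i x = v := by
  have h := (orthoBasis hx).sum_repr' v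
  simpa only [orthoBasis_apply] using h

variable [IsContMDiffRiemannianBundle (𝓡 m) ∞ (Model m) (fun x : M => TangentSpace (𝓡 m) x)]

theorem isC1Section_coordVec (hx : x ∈ (chartAt (Model m) c).source) (a : Model m) :
    IsC1Section m m id (fun y => coordVec m c y a) x :=
  contMDiffAt_coordVec hx a

theorem isC1Section_coordField (v : Tang m x) : IsC1Section m m id (coordField m x v) x :=
  isC1Section_coordVec (mem_chart_source (Model m) x) _

theorem contMDiffAt_inner_field {W Z : ∀ y : M, Tang m y}
    (hW : IsC1Section m m id W x) (hZ : IsC1Section m m id Z x) :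
    ContMDiffAt (𝓡 m) 𝓘(ℝ, ℝ) 1 (fun y => (inner ℝ (W y) (Z y) : ℝ)) x :=
  contMDiffAt_inner (u := (id : M → M)) hW hZ

/-- The Gram-Schmidt process preserves regularity: its coefficients are quotients of inner products
with nonvanishing denominators. -/
theorem isC1Section_gramSchmidt (hx : x ∈ (chartAt (Model m) c).source) (i : Fin m) :
    IsC1Section m m id (fun y => InnerProductSpace.gramSchmidt ℝ
      (fun j => coordVec m c y (EuclideanSpace.basisFun (Fin m) ℝ j)) i) x := by
  induction i using WellFoundedLT.induction with
  | ind i ih =>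
    have hid : ContMDiffAt (𝓡 m) (𝓡 m) ∞ (id : M → M) x := contMDiffAt_id
    have h1 : IsC1Section m m id (fun y => coordVec m c y (EuclideanSpace.basisFun (Fin m) ℝ i)
        + ∑ j ∈ Finset.Iio i, (-((inner ℝ (InnerProductSpace.gramSchmidt ℝ
          (fun j => coordVec m c y (EuclideanSpace.basisFun (Fin m) ℝ j)) j)
          (coordVec m c y (EuclideanSpace.basisFun (Fin m) ℝ i)) : ℝ) /
          (inner ℝ (InnerProductSpace.gramSchmidt ℝ
          (fun j => coordVec m c y (EuclideanSpace.basisFun (Fin m) ℝ j)) j)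
          (InnerProductSpace.gramSchmidt ℝ
          (fun j => coordVec m c y (EuclideanSpace.basisFun (Fin m) ℝ j)) j) : ℝ))) •
          InnerProductSpace.gramSchmidt ℝ
          (fun j => coordVec m c y (EuclideanSpace.basisFun (Fin m) ℝ j)) j) x := by
      refine (isC1Section_coordVec hx _).add hid (isC1Section_sum hid _ fun j hj => ?_)
      have hj' := ih j (Finset.mem_Iio.1 hj)
      refine hj'.smul hid ?_
      refine ((contMDiffAt_inner_field hj' (isC1Section_coordVec hx _)).div₀
        (contMDiffAt_inner_field hj' hj') ?_).neg
      rw [inner_self_ne_zero]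
      exact gramSchmidt_coordVec_ne_zero hx j
    refine h1.congr (Eventually.of_forall fun y => ?_)
    rw [InnerProductSpace.gramSchmidt_def, sub_eq_add_neg, ← Finset.sum_neg_distrib]
    congr 1
    refine Finset.sum_congr rfl fun j _ => ?_
    rw [Submodule.starProjection_singleton, neg_smul, real_inner_self_eq_norm_sq]
    rfl

theorem isC1Section_orthoFrame (hx : x ∈ (chartAt (Model m) c).source) (i : Fin m) :
    IsC1Section m m id (orthoFrame c i) x := by
  have hid : ContMDiffAt (𝓡 m) (𝓡 m) ∞ (id : M → M) x := contMDiffAt_id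
  have h := isC1Section_gramSchmidt hx i
  have h2 := contMDiffAt_inner_field h h
  have h3 : (inner ℝ (InnerProductSpace.gramSchmidt ℝ
      (fun j => coordVec m c x (EuclideanSpace.basisFun (Fin m) ℝ j)) i)
      (InnerProductSpace.gramSchmidt ℝ
      (fun j => coordVec m c x (EuclideanSpace.basisFun (Fin m) ℝ j)) i) : ℝ) ≠ 0 := by
    rw [inner_self_ne_zero]
    exact gramSchmidt_coordVec_ne_zero hx i
  have h4 := ContMDiffAt.comp (I' := 𝓘(ℝ, ℝ)) x
    (Real.contDiffAt_sqrt (n := 1) h3).contMDiffAt h2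
  refine (h.smul hid (h4.inv₀ (Real.sqrt_ne_zero'.2
    (lt_of_le_of_ne real_inner_self_nonneg h3.symm)))).congr (Eventually.of_forall fun y => ?_)
  rw [orthoFrame, InnerProductSpace.gramSchmidtNormed, norm_eq_sqrt_real_inner]
  rfl

end Frame

/-! ### Divergence of vector bundle valued 1-forms and regularity of the stress form -/

section Tensoriality

variable {m n : ℕ} {M N : Type*}
  [TopologicalSpace M] [ChartedSpace (Model m) M] [IsManifold (𝓡 m) ∞ M]
  [TopologicalSpace N] [ChartedSpace (Model n) N] [IsManifold (𝓡 n) ∞ N]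
  [RiemannianBundle (fun y : N => TangentSpace (𝓡 n) y)]
  [IsContMDiffRiemannianBundle (𝓡 n) ∞ (Model n) (fun y : N => TangentSpace (𝓡 n) y)]
  [RiemannianBundle (fun x : M => TangentSpace (𝓡 m) x)]
  [IsContMDiffRiemannianBundle (𝓡 m) ∞ (Model m) (fun x : M => TangentSpace (𝓡 m) x)]
  {u : M → N} {x : M} {c : M}

variable (m n) in
/-- The covariant derivative `(∇_v θ)(Y)` of a `u⁻¹TN`-valued 1-form `θ`. It depends on the vector
field `Y` only through its value at `x`, see `covDeriv_congr`. -/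
def covDeriv (u : M → N) (θ : ∀ y : M, Tang m y →ₗ[ℝ] Tang n (u y)) (Y : ∀ y : M, Tang m y)
    (x : M) (v : Tang m x) : Tang n (u x) :=
  pullbackConn m n u (fun y => θ y (Y y)) x v - θ x (leviCivita m Y x v)

variable (m n) in
/-- A `u⁻¹TN`-valued 1-form is `C¹` at `x` if it maps `C¹` vector fields to `C¹` sections. -/
def IsC1Form (u : M → N) (θ : ∀ y : M, Tang m y →ₗ[ℝ] Tang n (u y)) (x : M) : Prop :=
  ∀ Y : ∀ y : M, Tang m y, IsC1Section m m id Y x → IsC1Section m n u (fun y => θ y (Y y)) x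

theorem covDeriv_dir_add (θ : ∀ y : M, Tang m y →ₗ[ℝ] Tang n (u y)) (Y : ∀ y : M, Tang m y)
    (v w : Tang m x) :
    covDeriv m n u θ Y x (v + w) = covDeriv m n u θ Y x v + covDeriv m n u θ Y x w := by
  unfold covDeriv
  rw [pullbackConn_dir_add, leviCivita_eq, leviCivita_eq, leviCivita_eq, pullbackConn_dir_add]
  erw [map_add]
  abel

theorem covDeriv_dir_smul (θ : ∀ y : M, Tang m y →ₗ[ℝ] Tang n (u y)) (Y : ∀ y : M, Tang m y)
    (r : ℝ) (v : Tang m x) :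
    covDeriv m n u θ Y x (r • v) = r • covDeriv m n u θ Y x v := by
  unfold covDeriv
  rw [pullbackConn_dir_smul, leviCivita_eq, leviCivita_eq, pullbackConn_dir_smul, smul_sub]
  erw [map_smul]

/-- `covDeriv` as a linear map in the direction. -/
def covDerivₗ (u : M → N) (θ : ∀ y : M, Tang m y →ₗ[ℝ] Tang n (u y)) (Y : ∀ y : M, Tang m y)
    (x : M) : Tang m x →ₗ[ℝ] Tang n (u x) where
  toFun := covDeriv m n u θ Y x
  map_add' := covDeriv_dir_add θ Y
  map_smul' := covDeriv_dir_smul θ Y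

/-- Tensoriality of the covariant derivative of a 1-form, in terms of an orthonormal frame. -/
theorem covDeriv_eq_sum (hu : ContMDiff (𝓡 m) (𝓡 n) ∞ u)
    {θ : ∀ y : M, Tang m y →ₗ[ℝ] Tang n (u y)} (hθ : IsC1Form m n u θ x)
    {Y : ∀ y : M, Tang m y} (hY : IsC1Section m m id Y x)
    (hx : x ∈ (chartAt (Model m) c).source) (v : Tang m x) :
    covDeriv m n u θ Y x v
      = ∑ j, (inner ℝ (orthoFrame c j x) (Y x) : ℝ) • covDeriv m n u θ (orthoFrame c j) x v := by
  have hid : ContMDiffAt (𝓡 m) (𝓡 m) ∞ (id : M → M) x := contMDiffAt_id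
  have hs := fun j => isC1Section_orthoFrame hx j
  have hf := fun j => contMDiffAt_inner_field (hs j) hY
  have h1 : ∀ᶠ y in 𝓝 x, Y y
      = ∑ j, (inner ℝ (orthoFrame c j y) (Y y) : ℝ) • orthoFrame c j y := by
    filter_upwards [eventually_mem_source hx] with y hy
    exact (sum_inner_orthoFrame hy (Y y)).symm
  have h2 : ∀ᶠ y in 𝓝 x, θ y (Y y)
      = ∑ j, (inner ℝ (orthoFrame c j y) (Y y) : ℝ) • θ y (orthoFrame c j y) := by
    filter_upwards [h1] with y hy
    conv_lhs => rw [hy]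
    simp only [map_sum, map_smul]
  unfold covDeriv
  rw [pullbackConn_congr h2, leviCivita_eq,
    pullbackConn_congr (W := Y) (u := (id : M → M)) h1,
    pullbackConn_sum hu.contMDiffAt _ fun j _ => (hθ _ (hs j)).smul hu.contMDiffAt (hf j),
    pullbackConn_sum hid _ fun j _ => (hs j).smul hid (hf j), map_sum,
    ← Finset.sum_sub_distrib]
  refine Finset.sum_congr rfl fun j _ => ?_
  rw [pullbackConn_smul hu.contMDiffAt (hθ _ (hs j)) (hf j), pullbackConn_smul hid (hs j) (hf j),
    leviCivita_eq, map_add, map_smul, map_smul, smul_sub]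
  abel

theorem covDeriv_congr (hu : ContMDiff (𝓡 m) (𝓡 n) ∞ u)
    {θ : ∀ y : M, Tang m y →ₗ[ℝ] Tang n (u y)} (hθ : IsC1Form m n u θ x)
    {Y Y' : ∀ y : M, Tang m y} (hY : IsC1Section m m id Y x) (hY' : IsC1Section m m id Y' x)
    (h : Y x = Y' x) (v : Tang m x) :
    covDeriv m n u θ Y x v = covDeriv m n u θ Y' x v := by
  have hx := mem_chart_source (Model m) x
  rw [covDeriv_eq_sum hu hθ hY hx, covDeriv_eq_sum hu hθ hY' hx, h]

/-- The divergence of a 1-form may be computed in any `C¹` orthonormal frame. -/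
theorem divForm_eq_sum (hu : ContMDiff (𝓡 m) (𝓡 n) ∞ u)
    {θ : ∀ y : M, Tang m y →ₗ[ℝ] Tang n (u y)} (hθ : IsC1Form m n u θ x)
    (hx : x ∈ (chartAt (Model m) c).source) :
    divForm m n u (fun y => θ y) x
      = ∑ j, covDeriv m n u θ (orthoFrame c j) x (orthoFrame c j x) := by
  have h1 : divForm m n u (fun y => θ y) x
      = ∑ i, covDeriv m n u θ (coordField m x (frame m x i)) x (frame m x i) := rfl
  rw [h1]
  have h2 : ∀ i, covDeriv m n u θ (coordField m x (frame m x i)) x (frame m x i)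
      = ∑ j, (inner ℝ (orthoFrame c j x) (frame m x i) : ℝ) •
        covDeriv m n u θ (orthoFrame c j) x (frame m x i) := fun i => by
    rw [covDeriv_eq_sum hu hθ (isC1Section_coordField _) hx, coordField_self]
  simp only [h2]
  rw [Finset.sum_comm]
  refine Finset.sum_congr rfl fun j _ => ?_
  have h3 : covDeriv m n u θ (orthoFrame c j) x (orthoFrame c j x)
      = covDerivₗ u θ (orthoFrame c j) x
        (∑ i, (inner ℝ (frame m x i) (orthoFrame c j x) : ℝ) • frame m x i) := by
    rw [(frame m x).sum_repr']
    rfl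
  rw [h3, map_sum]
  refine Finset.sum_congr rfl fun i _ => ?_
  rw [map_smul, real_inner_comm]
  rfl

end Tensoriality

section Sigma

variable {m n : ℕ} {M N : Type*}
  [TopologicalSpace M] [ChartedSpace (Model m) M] [IsManifold (𝓡 m) ∞ M]
  [TopologicalSpace N] [ChartedSpace (Model n) N] [IsManifold (𝓡 n) ∞ N]
  [RiemannianBundle (fun y : N => TangentSpace (𝓡 n) y)]
  [RiemannianBundle (fun x : M => TangentSpace (𝓡 m) x)]
  {u : M → N} {x : M} {c : M} {F : ℝ → ℝ}

/-- `du` as a linear map, for the vector space structures underlying the Riemannian metrics. -/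
def duₗ (u : M → N) (x : M) : Tang m x →ₗ[ℝ] Tang n (u x) where
  toFun := du m n u x
  map_add' := map_add (du m n u x)
  map_smul' := map_smul (du m n u x)

theorem duₗ_apply (v : Tang m x) : duₗ u x v = du m n u x v := rfl

theorem sigma_add (v w : Tang m x) :
    sigma m n u x (v + w) = sigma m n u x v + sigma m n u x w := by
  simp only [sigma, ← duₗ_apply, map_add, inner_add_left, add_smul, Finset.sum_add_distrib]

theorem sigma_smul (r : ℝ) (v : Tang m x) :
    sigma m n u x (r • v) = r • sigma m n u x v := by
  simp only [sigma, ← duₗ_apply, map_smul, inner_smul_left, conj_trivial, mul_smul,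
    Finset.smul_sum]

/-- `σ_u` as a linear map. -/
def sigmaₗ (u : M → N) (x : M) : Tang m x →ₗ[ℝ] Tang n (u x) where
  toFun := sigma m n u x
  map_add' := sigma_add
  map_smul' := sigma_smul

/-- `σ_{F,u}` as a linear map. -/
def sigmaFₗ (F : ℝ → ℝ) (u : M → N) (x : M) : Tang m x →ₗ[ℝ] Tang n (u x) :=
  weight m n F u x • (sigmaₗ u x : Tang m x →ₗ[ℝ] Tang n (u x))

theorem sigma_eq_sum {ι : Type*} [Fintype ι] (b : OrthonormalBasis ι ℝ (Tang m x))
    (v : Tang m x) :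
    sigma m n u x v
      = ∑ j, (inner ℝ (du m n u x v) (du m n u x (b j)) : ℝ) • du m n u x (b j) :=
  sum_inner_smul_eq_of_orthonormalBasis (E := Tang m x) (H := Tang n (u x)) (frame m x) b
    (L := du m n u x) (map_add _) (map_smul _) (du m n u x v)

theorem inner_sigma_eq_sum {ι : Type*} [Fintype ι] (b : OrthonormalBasis ι ℝ (Tang m x))
    (v w : Tang m x) :
    (inner ℝ (sigma m n u x v) (du m n u x w) : ℝ)
      = ∑ j, (inner ℝ (du m n u x v) (du m n u x (b j)) : ℝ) *
        inner ℝ (du m n u x w) (du m n u x (b j)) := by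
  rw [sigma_eq_sum b, sum_inner]
  refine Finset.sum_congr rfl fun j _ => ?_
  rw [inner_smul_left, conj_trivial, real_inner_comm (du m n u x w)]

theorem inner_sigma_comm (v w : Tang m x) :
    (inner ℝ (sigma m n u x v) (du m n u x w) : ℝ)
      = inner ℝ (sigma m n u x w) (du m n u x v) := by
  rw [inner_sigma_eq_sum (frame m x), inner_sigma_eq_sum (frame m x)]
  exact Finset.sum_congr rfl fun j _ => mul_comm _ _

theorem pullbackNormSq_eq_sum {ι : Type*} [Fintype ι] (b : OrthonormalBasis ι ℝ (Tang m x)) :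
    pullbackNormSq m n u x
      = ∑ i, ∑ j, (inner ℝ (du m n u x (b i)) (du m n u x (b j)) : ℝ) ^ 2 := by
  have h : ∑ i, (inner ℝ (sigma m n u x (frame m x i)) (du m n u x (frame m x i)) : ℝ)
      = ∑ i, (inner ℝ (sigma m n u x (b i)) (du m n u x (b i)) : ℝ) :=
    sum_inner_eq_of_orthonormalBasis (E := Tang m x) (H := Tang n (u x)) (frame m x) b
      (S := sigma m n u x) (L := du m n u x) sigma_add sigma_smul (map_add _) (map_smul _)
  have h2 : pullbackNormSq m n u x
      = ∑ i, (inner ℝ (sigma m n u x (frame m x i)) (du m n u x (frame m x i)) : ℝ) := by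
    refine Finset.sum_congr rfl fun i _ => ?_
    rw [inner_sigma_eq_sum (frame m x)]
    exact Finset.sum_congr rfl fun j _ => pow_two _
  rw [h2, h]
  refine Finset.sum_congr rfl fun i _ => ?_
  rw [inner_sigma_eq_sum b]
  exact Finset.sum_congr rfl fun j _ => (pow_two _).symm

theorem pullbackNormSq_nonneg (u : M → N) (x : M) : 0 ≤ pullbackNormSq m n u x :=
  Finset.sum_nonneg fun _ _ => Finset.sum_nonneg fun _ _ => sq_nonneg _

variable
  [IsContMDiffRiemannianBundle (𝓡 n) ∞ (Model n) (fun y : N => TangentSpace (𝓡 n) y)]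
  [IsContMDiffRiemannianBundle (𝓡 m) ∞ (Model m) (fun x : M => TangentSpace (𝓡 m) x)]

theorem isC1Form_duₗ (hu : ContMDiff (𝓡 m) (𝓡 n) ∞ u) (x : M) :
    IsC1Form m n u (fun y => duₗ u y) x :=
  fun _ hY => hY.du hu

theorem isC1Form_sigmaₗ (hu : ContMDiff (𝓡 m) (𝓡 n) ∞ u) (x : M) :
    IsC1Form m n u (fun y => sigmaₗ u y) x := by
  intro Y hY
  have hx := mem_chart_source (Model m) x
  have hs := fun j => (isC1Section_orthoFrame hx j).du hu
  refine (isC1Section_sum hu.contMDiffAt Finset.univ fun j _ =>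
    (hs j).smul hu.contMDiffAt (contMDiffAt_inner (hY.du hu) (hs j))).congr ?_
  filter_upwards [eventually_mem_source hx] with y hy
  have h := sigma_eq_sum (u := u) (n := n) (orthoBasis hy) (Y y)
  simp only [orthoBasis_apply] at h
  exact h

theorem pullbackNormSq_eventuallyEq (u : M → N) (x : M) :
    pullbackNormSq m n u =ᶠ[𝓝 x] fun y => ∑ i, ∑ j, (inner ℝ
      (du m n u y (orthoFrame x i y)) (du m n u y (orthoFrame x j y)) : ℝ) ^ 2 := by
  filter_upwards [eventually_mem_source (mem_chart_source (Model m) x)] with y hy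
  rw [pullbackNormSq_eq_sum (orthoBasis hy)]
  simp only [orthoBasis_apply]

theorem contMDiffAt_pullbackNormSq (hu : ContMDiff (𝓡 m) (𝓡 n) ∞ u) (x : M) :
    ContMDiffAt (𝓡 m) 𝓘(ℝ, ℝ) 1 (pullbackNormSq m n u) x := by
  have hs := fun j => (isC1Section_orthoFrame (mem_chart_source (Model m) x) j).du hu
  refine ContMDiffAt.congr_of_eventuallyEq ?_ (pullbackNormSq_eventuallyEq u x)
  exact contMDiffAt_finsetSum fun i _ => contMDiffAt_finsetSum fun j _ =>
    (contMDiffAt_inner (hs i) (hs j)).pow 2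

theorem contMDiffAt_weight (hF : ContDiffOn ℝ 2 F (Set.Ici 0)) (hu : ContMDiff (𝓡 m) (𝓡 n) ∞ u)
    (x : M) : ContMDiffAt (𝓡 m) 𝓘(ℝ, ℝ) 1 (weight m n F u) x := by
  have h1 : ContDiffOn ℝ 1 (derivWithin F (Set.Ici 0)) (Set.Ici 0) :=
    hF.derivWithin (uniqueDiffOn_Ici 0) (by norm_num)
  have h2 : ContMDiffAt (𝓡 m) 𝓘(ℝ, ℝ) 1 (fun y => pullbackNormSq m n u y / 4) x :=
    (contMDiffAt_pullbackNormSq hu x).div_const 4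
  have h3 : ∀ y, pullbackNormSq m n u y / 4 ∈ Set.Ici (0 : ℝ) := fun y =>
    div_nonneg (pullbackNormSq_nonneg u y) (by norm_num)
  have h4 := (h1 _ (h3 x)).contMDiffWithinAt
  rw [← contMDiffWithinAt_univ] at h2 ⊢
  exact ContMDiffWithinAt.comp (g := derivWithin F (Set.Ici 0)) x h4 h2 fun y _ => h3 y

theorem isC1Form_sigmaFₗ (hF : ContDiffOn ℝ 2 F (Set.Ici 0)) (hu : ContMDiff (𝓡 m) (𝓡 n) ∞ u)
    (x : M) : IsC1Form m n u (fun y => sigmaFₗ F u y) x := by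
  intro Y hY
  exact (isC1Form_sigmaₗ hu x Y hY).smul hu.contMDiffAt (contMDiffAt_weight hF hu x)

end Sigma

/-! ### The divergence of the stress-energy tensor -/

theorem sum_mul_eq_zero_of_antisymm {ι : Type*} [Fintype ι] {a b : ι → ι → ℝ}
    (ha : ∀ i j, a i j + a j i = 0) (hb : ∀ i j, b i j = b j i) : ∑ i, ∑ j, a i j * b i j = 0 := by
  have h : ∑ i, ∑ j, a i j * b i j = -∑ i, ∑ j, a i j * b i j := by
    conv_lhs => rw [Finset.sum_comm]
    rw [← Finset.sum_neg_distrib]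
    refine Finset.sum_congr rfl fun i _ => ?_
    rw [← Finset.sum_neg_distrib]
    refine Finset.sum_congr rfl fun j _ => ?_
    rw [hb j i, eq_neg_of_add_eq_zero_left (ha j i)]
    ring
  linarith

section Identity

variable {m n : ℕ} {M N : Type*}
  [TopologicalSpace M] [ChartedSpace (Model m) M] [IsManifold (𝓡 m) ∞ M]
  [TopologicalSpace N] [ChartedSpace (Model n) N] [IsManifold (𝓡 n) ∞ N]
  [RiemannianBundle (fun y : N => TangentSpace (𝓡 n) y)]
  [RiemannianBundle (fun x : M => TangentSpace (𝓡 m) x)]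
  [IsContMDiffRiemannianBundle (𝓡 n) ∞ (Model n) (fun y : N => TangentSpace (𝓡 n) y)]
  [IsContMDiffRiemannianBundle (𝓡 m) ∞ (Model m) (fun x : M => TangentSpace (𝓡 m) x)]
  {u : M → N} {x : M} {c : M} {F : ℝ → ℝ}

theorem dirDeriv_inner_field {W Z : ∀ y : M, Tang m y}
    (hW : IsC1Section m m id W x) (hZ : IsC1Section m m id Z x) (v : Tang m x) :
    dirDeriv m (fun y => (inner ℝ (W y) (Z y) : ℝ)) x v
      = inner ℝ (leviCivita m W x v) (Z x) + inner ℝ (W x) (leviCivita m Z x v) := by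
  rw [leviCivita_eq, leviCivita_eq]
  exact dirDeriv_inner (u := (id : M → M)) contMDiffAt_id hW hZ v

/-- The connection coefficients of an orthonormal frame are antisymmetric. -/
theorem inner_leviCivita_orthoFrame_antisymm (hx : x ∈ (chartAt (Model m) c).source)
    (v : Tang m x) (i j : Fin m) :
    (inner ℝ (orthoFrame c j x) (leviCivita m (orthoFrame c i) x v) : ℝ)
      + inner ℝ (orthoFrame c i x) (leviCivita m (orthoFrame c j) x v) = 0 := by
  have h1 := dirDeriv_inner_field (isC1Section_orthoFrame hx i) (isC1Section_orthoFrame hx j) v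
  have h2 : (fun y => (inner ℝ (orthoFrame c i y) (orthoFrame c j y) : ℝ)) =ᶠ[𝓝 x]
      fun _ => if i = j then 1 else 0 := by
    filter_upwards [eventually_mem_source hx] with y hy
    rw [← orthoBasis_apply hy, ← orthoBasis_apply hy]
    exact (orthonormal_iff_ite.1 (orthoBasis hy).orthonormal) i j
  rw [dirDeriv_congr h2, dirDeriv_const, real_inner_comm] at h1
  exact h1.symm

theorem covDeriv_duₗ_coordField_comm (hu : ContMDiff (𝓡 m) (𝓡 n) ∞ u) (v w : Tang m x) :
    covDeriv m n u (fun y => duₗ u y) (coordField m x w) x v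
      = covDeriv m n u (fun y => duₗ u y) (coordField m x v) x w :=
  secondFundamentalForm_symm hu v w

/-- The derivative of `‖u^*h‖²`, by the Leibniz rule in an orthonormal frame of class `C¹`. -/
theorem dirDeriv_pullbackNormSq_frame (hu : ContMDiff (𝓡 m) (𝓡 n) ∞ u) (w : Tang m x) :
    dirDeriv m (pullbackNormSq m n u) x w
      = 4 * ∑ i, (inner ℝ (sigma m n u x (orthoFrame x i x))
          (pullbackConn m n u (fun y => du m n u y (orthoFrame x i y)) x w) : ℝ) := by
  have hx := mem_chart_source (Model m) x
  have hs := fun j => (isC1Section_orthoFrame hx j).du hu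
  have hg : ∀ i j, MDifferentiableAt (𝓡 m) 𝓘(ℝ, ℝ) (fun y => (inner ℝ
      (du m n u y (orthoFrame x i y)) (du m n u y (orthoFrame x j y)) : ℝ)) x := fun i j =>
    (contMDiffAt_inner (hs i) (hs j)).mdifferentiableAt one_ne_zero
  have h1 : pullbackNormSq m n u =ᶠ[𝓝 x] fun y => ∑ i, ∑ j, (inner ℝ
      (du m n u y (orthoFrame x i y)) (du m n u y (orthoFrame x j y)) : ℝ) * inner ℝ
      (du m n u y (orthoFrame x i y)) (du m n u y (orthoFrame x j y)) := by
    refine (pullbackNormSq_eventuallyEq u x).trans (Eventually.of_forall fun y => ?_)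
    simp only [pow_two]
  have hgg : ∀ i j, MDifferentiableAt (𝓡 m) 𝓘(ℝ, ℝ) (fun y => (inner ℝ
      (du m n u y (orthoFrame x i y)) (du m n u y (orthoFrame x j y)) : ℝ) * inner ℝ
      (du m n u y (orthoFrame x i y)) (du m n u y (orthoFrame x j y))) x := fun i j =>
    mdifferentiableAt_bilin (ContinuousLinearMap.lsmul ℝ ℝ) (hg i j) (hg i j)
  rw [dirDeriv_congr h1, (dirDeriv_sum Finset.univ (fun i _ =>
    (dirDeriv_sum Finset.univ (fun j _ => hgg i j) w).1) w).2]
  have h2 : ∀ i, dirDeriv m (fun y => ∑ j, (inner ℝ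
      (du m n u y (orthoFrame x i y)) (du m n u y (orthoFrame x j y)) : ℝ) * inner ℝ
      (du m n u y (orthoFrame x i y)) (du m n u y (orthoFrame x j y))) x w
      = ∑ j, (2 * ((inner ℝ (du m n u x (orthoFrame x i x)) (du m n u x (orthoFrame x j x)) : ℝ)
          * inner ℝ (du m n u x (orthoFrame x j x))
            (pullbackConn m n u (fun y => du m n u y (orthoFrame x i y)) x w))
        + 2 * ((inner ℝ (du m n u x (orthoFrame x j x)) (du m n u x (orthoFrame x i x)) : ℝ)
          * inner ℝ (du m n u x (orthoFrame x i x))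
            (pullbackConn m n u (fun y => du m n u y (orthoFrame x j y)) x w))) := by
    intro i
    rw [(dirDeriv_sum Finset.univ (fun j _ => hgg i j) w).2]
    refine Finset.sum_congr rfl fun j _ => ?_
    rw [dirDeriv_mul (hg i j) (hg i j), dirDeriv_inner hu.contMDiffAt (hs i) (hs j),
      real_inner_comm (du m n u x (orthoFrame x j x))
        (pullbackConn m n u (fun y => du m n u y (orthoFrame x i y)) x w),
      real_inner_comm (du m n u x (orthoFrame x i x)) (du m n u x (orthoFrame x j x))]
    ring
  have h3 : ∀ i, (inner ℝ (sigma m n u x (orthoFrame x i x))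
      (pullbackConn m n u (fun y => du m n u y (orthoFrame x i y)) x w) : ℝ)
      = ∑ j, (inner ℝ (du m n u x (orthoFrame x i x)) (du m n u x (orthoFrame x j x)) : ℝ)
          * inner ℝ (du m n u x (orthoFrame x j x))
            (pullbackConn m n u (fun y => du m n u y (orthoFrame x i y)) x w) := by
    intro i
    rw [sigma_eq_sum (orthoBasis hx), sum_inner]
    refine Finset.sum_congr rfl fun j _ => ?_
    rw [inner_smul_left, conj_trivial, orthoBasis_apply]
  simp only [h2, h3, Finset.sum_add_distrib, ← Finset.mul_sum]
  rw [Finset.sum_comm (f := fun i j =>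
    (inner ℝ (du m n u x (orthoFrame x j x)) (du m n u x (orthoFrame x i x)) : ℝ)
      * inner ℝ (du m n u x (orthoFrame x i x))
        (pullbackConn m n u (fun y => du m n u y (orthoFrame x j y)) x w))]
  ring

/-- The derivative of `‖u^*h‖²` in terms of the second fundamental form of `u`. -/
theorem dirDeriv_pullbackNormSq (hu : ContMDiff (𝓡 m) (𝓡 n) ∞ u) (w : Tang m x) :
    dirDeriv m (pullbackNormSq m n u) x w
      = 4 * ∑ i, (inner ℝ (sigma m n u x (frame m x i))
          (covDeriv m n u (fun y => duₗ u y) (coordField m x w) x (frame m x i)) : ℝ) := by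
  have hx := mem_chart_source (Model m) x
  rw [dirDeriv_pullbackNormSq_frame hu]
  congr 1
  have h1 : ∀ i, pullbackConn m n u (fun y => du m n u y (orthoFrame x i y)) x w
      = covDeriv m n u (fun y => duₗ u y) (coordField m x w) x (orthoFrame x i x)
        + du m n u x (leviCivita m (orthoFrame x i) x w) := by
    intro i
    rw [covDeriv_duₗ_coordField_comm hu,
      covDeriv_congr hu (isC1Form_duₗ hu x) (isC1Section_coordField _)
        (isC1Section_orthoFrame hx i) (coordField_self _)]
    unfold covDeriv
    exact (sub_add_cancel _ _).symm
  have h2 : ∀ i, (inner ℝ (sigma m n u x (orthoFrame x i x))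
      (du m n u x (leviCivita m (orthoFrame x i) x w)) : ℝ)
      = ∑ k, (inner ℝ (orthoFrame x k x) (leviCivita m (orthoFrame x i) x w) : ℝ)
        * inner ℝ (sigma m n u x (orthoFrame x i x)) (du m n u x (orthoFrame x k x)) := by
    intro i
    have h3 := congrArg (duₗ (n := n) u x)
      (sum_inner_orthoFrame hx (leviCivita m (orthoFrame x i) x w))
    rw [map_sum] at h3
    rw [← duₗ_apply (leviCivita m (orthoFrame x i) x w), ← h3, inner_sum]
    refine Finset.sum_congr rfl fun k _ => ?_
    rw [map_smul, inner_smul_right, duₗ_apply]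
  simp only [h1, inner_add_right, Finset.sum_add_distrib, h2]
  -- Antisymmetric connection coefficients are contracted with the symmetric form `⟨σ_u, du⟩`.
  rw [sum_mul_eq_zero_of_antisymm
    (fun i j => inner_leviCivita_orthoFrame_antisymm hx w i j)
    (fun i j => inner_sigma_comm (orthoFrame x i x) (orthoFrame x j x)), add_zero]
  have h4 := sum_inner_eq_of_orthonormalBasis (E := Tang m x) (H := Tang n (u x))
    (orthoBasis hx) (frame m x) (S := sigma m n u x)
    (L := covDeriv m n u (fun y => duₗ u y) (coordField m x w) x) sigma_add sigma_smul
    (covDeriv_dir_add _ _) (covDeriv_dir_smul _ _)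
  simp only [orthoBasis_apply] at h4
  exact h4

/-- The derivative of the energy density. The scalar factor `F'` turns `σ_u` into `σ_{F,u}`. -/
theorem dirDeriv_density (hF : ContDiffOn ℝ 2 F (Set.Ici 0)) (hu : ContMDiff (𝓡 m) (𝓡 n) ∞ u)
    (w : Tang m x) :
    MDifferentiableAt (𝓡 m) 𝓘(ℝ, ℝ) (fun y => F (pullbackNormSq m n u y / 4)) x ∧
    dirDeriv m (fun y => F (pullbackNormSq m n u y / 4)) x w
      = ∑ i, (inner ℝ (sigmaF m n F u x (frame m x i))
          (covDeriv m n u (fun y => duₗ u y) (coordField m x w) x (frame m x i)) : ℝ) := by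
  have h1 := (contMDiffAt_pullbackNormSq hu x).mdifferentiableAt one_ne_zero
  have h2 : MDifferentiableAt (𝓡 m) 𝓘(ℝ, ℝ) (fun y => pullbackNormSq m n u y * 4⁻¹) x :=
    mdifferentiableAt_bilin (ContinuousLinearMap.lsmul ℝ ℝ) h1 mdifferentiableAt_const
  have hpos : ∀ y, 0 ≤ pullbackNormSq m n u y * 4⁻¹ := fun y =>
    mul_nonneg (pullbackNormSq_nonneg u y) (by norm_num)
  have h3 := dirDeriv_comp_derivWithin h2 hpos
    (hF.differentiableOn (by norm_num) _ (Set.mem_Ici.2 (hpos x))) w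
  simp only [div_eq_mul_inv]
  refine ⟨h3.1, ?_⟩
  rw [h3.2, dirDeriv_mul h1 mdifferentiableAt_const, dirDeriv_const, dirDeriv_pullbackNormSq hu,
    mul_zero, add_zero, mul_comm (4 : ℝ), mul_assoc, mul_inv_cancel₀ (by norm_num), mul_one,
    Finset.mul_sum]
  refine Finset.sum_congr rfl fun i _ => ?_
  rw [sigmaF, inner_smul_left, conj_trivial, weight, div_eq_mul_inv]

theorem stressEnergy_eq (y : M) (v w : Tang m y) :
    stressEnergy m n F u y v w = F (pullbackNormSq m n u y / 4) * inner ℝ v w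
      - inner ℝ (sigmaF m n F u y v) (du m n u y w) := by
  rw [stressEnergy, sigmaF, inner_smul_left, conj_trivial]

/-- The divergence of the stress-energy tensor is `-⟨div σ_{F,u}, du⟩`. -/
theorem divTensor_stressEnergy (hF : ContDiffOn ℝ 2 F (Set.Ici 0))
    (hu : ContMDiff (𝓡 m) (𝓡 n) ∞ u) (x : M) (w : Tang m x) :
    divTensor m (stressEnergy m n F u) x w
      = -inner ℝ (divForm m n u (sigmaF m n F u) x) (du m n u x w) := by
  have hE := fun v : Tang m x => isC1Section_coordField v
  have hθ : ∀ v : Tang m x, IsC1Section m n u (fun y => sigmaF m n F u y (coordField m x v y)) x :=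
    fun v => isC1Form_sigmaFₗ hF hu x _ (hE v)
  -- Each summand, after the Leibniz rule: the terms with `∇_{e_k} e_k` and `∇_{e_k} w` against the
  -- metric cancel.
  have hterm : ∀ k, dirDeriv m (fun y => stressEnergy m n F u y
        (coordField m x (frame m x k) y) (coordField m x w y)) x (frame m x k)
      - stressEnergy m n F u x (leviCivita m (coordField m x (frame m x k)) x (frame m x k)) w
      - stressEnergy m n F u x (frame m x k) (leviCivita m (coordField m x w) x (frame m x k))
      = dirDeriv m (fun y => F (pullbackNormSq m n u y / 4)) x (frame m x k)
          * inner ℝ (frame m x k) w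
        - inner ℝ (pullbackConn m n u
            (fun y => sigmaF m n F u y (coordField m x (frame m x k) y)) x (frame m x k)
            - sigmaF m n F u x (leviCivita m (coordField m x (frame m x k)) x (frame m x k)))
            (du m n u x w)
        - inner ℝ (sigmaF m n F u x (frame m x k))
          (covDeriv m n u (fun y => duₗ u y) (coordField m x w) x (frame m x k)) := by
    intro k
    have hf := (dirDeriv_density (x := x) hF hu (frame m x k)).1
    have h1 := (contMDiffAt_inner_field (hE (frame m x k)) (hE w)).mdifferentiableAt one_ne_zero
    have h2 := (contMDiffAt_inner (hθ (frame m x k)) ((hE w).du hu)).mdifferentiableAt one_ne_zero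
    have h3 : MDifferentiableAt (𝓡 m) 𝓘(ℝ, ℝ) (fun y => F (pullbackNormSq m n u y / 4)
        * (inner ℝ (coordField m x (frame m x k) y) (coordField m x w y) : ℝ)) x :=
      mdifferentiableAt_bilin (ContinuousLinearMap.lsmul ℝ ℝ) hf h1
    unfold covDeriv
    simp only [stressEnergy_eq]
    rw [dirDeriv_sub h3 h2, dirDeriv_mul hf h1, dirDeriv_inner_field (hE _) (hE w),
      dirDeriv_inner hu.contMDiffAt (hθ _) ((hE w).du hu)]
    simp only [coordField_self, inner_sub_left, inner_sub_right, duₗ_apply]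
    ring
  have hsum : ∑ k, dirDeriv m (fun y => F (pullbackNormSq m n u y / 4)) x (frame m x k)
      * (inner ℝ (frame m x k) w : ℝ) = dirDeriv m (fun y => F (pullbackNormSq m n u y / 4)) x w := by
    let D : Tang m x →ₗ[ℝ] ℝ :=
      { toFun := dirDeriv m (fun y => F (pullbackNormSq m n u y / 4)) x
        map_add' := dirDeriv_dir_add _
        map_smul' := dirDeriv_dir_smul _ }
    have h4 : D (∑ k, (inner ℝ (frame m x k) w : ℝ) • frame m x k) = D w := by
      rw [(frame m x).sum_repr']
    rw [map_sum] at h4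
    refine Eq.trans (Finset.sum_congr rfl fun k _ => ?_) h4
    rw [map_smul, smul_eq_mul, mul_comm]
    rfl
  unfold divTensor divForm
  simp only [hterm, Finset.sum_sub_distrib, hsum]
  rw [(dirDeriv_density hF hu w).2, ← sum_inner, Finset.sum_sub_distrib]
  ring

end Identity

/-! ### Density, continuity and the equivalence -/

section Density

variable {m n : ℕ} {M N : Type*}
  [TopologicalSpace M] [ChartedSpace (Model m) M] [IsManifold (𝓡 m) ∞ M]
  [TopologicalSpace N] [ChartedSpace (Model n) N] [IsManifold (𝓡 n) ∞ N]
  {u : M → N}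

/-- The complement of a null set is dense. -/
theorem IsNull.dense_compl {A : Set M} (hA : IsNull m A) : Dense Aᶜ := by
  rw [← interior_eq_empty_iff_dense_compl]
  by_contra h
  obtain ⟨x, hx⟩ := Set.nonempty_iff_ne_empty.2 h
  have hopen := (chartAt (Model m) x).isOpen_image_of_subset_source
    ((isOpen_interior (s := A)).inter (chartAt (Model m) x).open_source) Set.inter_subset_right
  have hpos := hopen.measure_pos MeasureTheory.volume
    ⟨_, Set.mem_image_of_mem (chartAt (Model m) x) ⟨hx, mem_chart_source (Model m) x⟩⟩
  refine hpos.ne' (MeasureTheory.measure_mono_null (Set.image_mono ?_)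
    (hA _ (chart_mem_atlas (Model m) x)))
  exact Set.inter_subset_inter_left _ interior_subset

theorem IsSubmersionAE.dense (h : IsSubmersionAE m n u) :
    Dense {x : M | Function.Surjective (du m n u x)} := by
  refine (IsNull.dense_compl h).mono fun x hx => ?_
  exact not_not.1 hx

end Density

section Continuity

variable {m n : ℕ} {M N : Type*}
  [TopologicalSpace M] [ChartedSpace (Model m) M] [IsManifold (𝓡 m) ∞ M]
  [TopologicalSpace N] [ChartedSpace (Model n) N] [IsManifold (𝓡 n) ∞ N]
  [RiemannianBundle (fun y : N => TangentSpace (𝓡 n) y)]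
  [IsContMDiffRiemannianBundle (𝓡 n) ∞ (Model n) (fun y : N => TangentSpace (𝓡 n) y)]
  {u : M → N} {x : M} {F : ℝ → ℝ}

/-- The induced covariant derivative of a `C¹` section is continuous, tested against `C¹` sections:
near `x` it may be computed in the single chart at `u x`. -/
theorem continuousAt_inner_pullbackConn (hu : ContMDiff (𝓡 m) (𝓡 n) ∞ u)
    {W Z : ∀ y : M, Tang n (u y)} {Y : ∀ y : M, Tang m y}
    (hW : IsC1Section m n u W x) (hZ : IsC1Section m n u Z x) (hY : IsC1Section m m id Y x) :
    ContinuousAt (fun y => (inner ℝ (pullbackConn m n u W y (Y y)) (Z y) : ℝ)) x := by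
  have hx := mem_chart_source (Model n) (u x)
  have huc : ContinuousAt u x := hu.continuous.continuousAt
  have hG := contMDiffAt_gramForm hx
  have hWc := hW.coordComp hx
  have hZc := (hZ.coordComp hx).continuousAt
  have hVc := ((hY.du hu).coordComp hx).continuousAt
  have h1 : (fun y => gramForm n (u x) (u y)
        (dirDeriv m (fun y => coordComp n (u x) (u y) (W y)) y (Y y))
        (coordComp n (u x) (u y) (Z y))
      + koszulForm (u x) (u y) (du m n u y (Y y)) (W y) (Z y)) =ᶠ[𝓝 x]
      fun y => (inner ℝ (pullbackConn m n u W y (Y y)) (Z y) : ℝ) := by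
    filter_upwards [eventually_map_mem_source hx huc, hW.eventually] with y hy hWy
    rw [pullbackConn_eq_connAt hu.contMDiffAt hy hWy, connAt, inner_add_left,
      inner_christoffelAt hy, inner_eq_gramForm hy, coordComp_coordVec hy]
  refine ContinuousAt.congr ?_ h1
  have hD : ContinuousAt
      (fun y => dirDeriv m (fun y => coordComp n (u x) (u y) (W y)) y (Y y)) x :=
    continuousAt_dirDeriv (u := (id : M → M)) (mem_chart_source (Model m) x) continuousAt_id hWc
      (hY.coordComp (mem_chart_source (Model m) x)).continuousAt
  have hGu : ContinuousAt (fun y => gramForm n (u x) (u y)) x :=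
    ContinuousAt.comp (g := gramForm n (u x)) hG.continuousAt huc
  refine ((hGu.clm_apply hD).clm_apply hZc).add ?_
  unfold koszulForm metricDerivAt
  exact (((((continuousAt_dirDeriv hx huc hG hVc).clm_apply hWc.continuousAt).clm_apply hZc).add
    (((continuousAt_dirDeriv hx huc hG hWc.continuousAt).clm_apply hVc).clm_apply hZc)).sub
    (((continuousAt_dirDeriv hx huc hG hZc).clm_apply hVc).clm_apply
      hWc.continuousAt)).div_const 2

variable [RiemannianBundle (fun x : M => TangentSpace (𝓡 m) x)]
  [IsContMDiffRiemannianBundle (𝓡 m) ∞ (Model m) (fun x : M => TangentSpace (𝓡 m) x)]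

/-- The divergence of a `C¹` 1-form is continuous, tested against `C¹` sections. Near `x` it is
computed in the single orthonormal frame of the chart at `x`, in which also `∇_{e_j} e_j` is
expanded, so that only inner products of `C¹` sections and their derivatives occur. -/
theorem continuousAt_inner_divForm (hu : ContMDiff (𝓡 m) (𝓡 n) ∞ u)
    {θ : ∀ y : M, Tang m y →ₗ[ℝ] Tang n (u y)} (hθ : ∀ y, IsC1Form m n u θ y)
    {Z : ∀ y : M, Tang n (u y)} (hZ : IsC1Section m n u Z x) :
    ContinuousAt (fun y => (inner ℝ (divForm m n u (fun y => θ y) y) (Z y) : ℝ)) x := by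
  have hx := mem_chart_source (Model m) x
  have hs := fun j => isC1Section_orthoFrame hx j
  have h1 : (fun y => ∑ j, ((inner ℝ (pullbackConn m n u (fun y => θ y (orthoFrame x j y)) y
        (orthoFrame x j y)) (Z y) : ℝ)
      - ∑ k, (inner ℝ (pullbackConn m m id (orthoFrame x j) y (orthoFrame x j y))
          (orthoFrame x k y) : ℝ) * inner ℝ (θ y (orthoFrame x k y)) (Z y))) =ᶠ[𝓝 x]
      fun y => (inner ℝ (divForm m n u (fun y => θ y) y) (Z y) : ℝ) := by
    filter_upwards [eventually_mem_source hx] with y hy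
    rw [divForm_eq_sum hu (hθ y) hy, sum_inner]
    refine Finset.sum_congr rfl fun j _ => ?_
    have h3 := congrArg (θ y) (sum_inner_orthoFrame hy
      (leviCivita m (orthoFrame x j) y (orthoFrame x j y)))
    rw [map_sum] at h3
    rw [covDeriv, inner_sub_left, ← h3, sum_inner]
    congr 1
    refine Finset.sum_congr rfl fun k _ => ?_
    rw [map_smul, inner_smul_left, conj_trivial, leviCivita_eq,
      real_inner_comm (orthoFrame x k y)]
  refine ContinuousAt.congr ?_ h1
  refine tendsto_finsetSum _ fun j _ => ?_
  refine ContinuousAt.sub (continuousAt_inner_pullbackConn hu (hθ x _ (hs j)) hZ (hs j)) ?_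
  refine tendsto_finsetSum _ fun k _ => ?_
  exact ContinuousAt.mul
    (continuousAt_inner_pullbackConn (u := (id : M → M)) contMDiff_id (hs j) (hs k) (hs j))
    (contMDiffAt_inner (hθ x _ (hs k)) hZ).continuousAt

end Continuity

end PhiF

end

theorem corollary2p6 (m n : ℕ) {M N : Type*}
    [TopologicalSpace M] [ChartedSpace (PhiF.Model m) M] [IsManifold (𝓡 m) ∞ M]
    [T2Space M] [SecondCountableTopology M]
    [TopologicalSpace N] [ChartedSpace (PhiF.Model n) N] [IsManifold (𝓡 n) ∞ N]
    [T2Space N] [SecondCountableTopology N]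
    [RiemannianBundle (fun x : M => TangentSpace (𝓡 m) x)]
    [IsContMDiffRiemannianBundle (𝓡 m) ∞ (PhiF.Model m) (fun x : M => TangentSpace (𝓡 m) x)]
    [RiemannianBundle (fun y : N => TangentSpace (𝓡 n) y)]
    [IsContMDiffRiemannianBundle (𝓡 n) ∞ (PhiF.Model n) (fun y : N => TangentSpace (𝓡 n) y)]
    (F : ℝ → ℝ) (hFC2 : ContDiffOn ℝ 2 F (Set.Ici 0)) (hFnonneg : ∀ t, 0 ≤ t → 0 ≤ F t)
    (hF0 : F 0 = 0) (hFpos : ∀ t, 0 < t → 0 < derivWithin F (Set.Ici 0) t)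
    (u : M → N) (hu : ContMDiff (𝓡 m) (𝓡 n) ∞ u) (hsub : PhiF.IsSubmersionAE m n u) :
    PhiF.IsStationary m n F u ↔ PhiF.IsDivergenceFreeStress m n F u := by
  constructor
  · intro h x w
    rw [PhiF.divTensor_stressEnergy hFC2 hu, h x, inner_zero_left, neg_zero]
  · intro h x
    have hzero : ∀ y, Function.Surjective (PhiF.du m n u y) →
        PhiF.divForm m n u (PhiF.sigmaF m n F u) y = 0 := by
      intro y hy
      obtain ⟨w, hw⟩ := hy (PhiF.divForm m n u (PhiF.sigmaF m n F u) y)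
      have h1 := h y w
      rw [PhiF.divTensor_stressEnergy hFC2 hu, hw, neg_eq_zero] at h1
      exact inner_self_eq_zero.1 h1
    -- Test `div σ_{F,u}` against a `C¹` section that extends its value at `x`.
    have hx := mem_chart_source (PhiF.Model n) (u x)
    have hc := PhiF.continuousAt_inner_divForm hu
      (fun y => PhiF.isC1Form_sigmaFₗ hFC2 hu y)
      (PhiF.isC1Section_coordVec_comp hx hu.contMDiffAt
        (PhiF.coordComp n (u x) (u x) (PhiF.divForm m n u (PhiF.sigmaF m n F u) x)))
    have hfreq : ∃ᶠ y in nhds x, (inner ℝ (PhiF.divForm m n u (PhiF.sigmaF m n F u) y)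
        (PhiF.coordVec n (u x) (u y) (PhiF.coordComp n (u x) (u x)
          (PhiF.divForm m n u (PhiF.sigmaF m n F u) x))) : ℝ) = 0 :=
      (mem_closure_iff_frequently.1 (hsub.dense x)).mono fun y hy => by
        rw [hzero y hy, inner_zero_left]
    have h2 := tendsto_nhds_unique_of_frequently_eq hc tendsto_const_nhds hfreq
    have h3 := PhiF.coordVec_coordComp hx (PhiF.divForm m n u (PhiF.sigmaF m n F u) x)
    simp only [h3] at h2
    exact inner_self_eq_zero.1 h2
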